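/- **Notation.** For real $t$ let $[t]=\{n\in\mathbb Z: 1\le n\le t\}$, and let $\mathbb E_{x\in S}$ denote the average over a finite set $S$. A function $f:\mathbb Z\to\mathbb C$ is $1$-bounded if $|f(x)|\le 1$ for all $x$. Write $\Delta_hf(x)=f(x+h)\overline{f(x)}$, $\Delta_{h_1,\dots,h_s}f=\Delta_{h_1}\cdots\Delta_{h_s}f$, and, for $\delta,M>0$, $$\mu_{\delta,M}(h)=\frac{\#\{(h_1,h_2)\in[\delta M]^2:h_1-h_2=h\}}{\delta^2M}.$$ For finitely supported $f$ let $\|f\|_{U^s}^{2^s}=\sum_{x,h_1,\dots,h_s\in\mathbb Z}\Delta_{h_1,\dots,h_s}f(x)$, and $\|f\|_{U^s(T)}=\|f1_T\|_{U^s}$ for $T\subset\mathbb Z$. All implied constants below are absolute. **Lemma 5.5.** There is an absolute constant $C>0$ such that the following holds. Let $N>0$ be real, $M=N^{1/2}$, and let $\delta_1,\delta_2,\delta_3,\delta_4>0$ satisfy $\delta_1/\delta_2<C\delta_4$ and $\delta_3<C\delta_1^3\delta_4$. For all but $O(\delta_1\delta_2M)$ of the $b\in[\delta_2M]$ the following is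 true: for every $1$-bounded $f:\mathbb Z\to\mathbb C$ supported in $[N]$, if $$\mathbb E_{a\in[\delta_2M]}\sum_{x,h_1,h_2\in\mathbb Z}\mu_{\delta_3,M}(h_1)\mu_{\delta_3,M}(h_2)\Delta_{2(a+b)h_1,\,2ah_2}f(x)\ \ge\ \delta_4NM^2,$$ then $$\|f\|_{U^4}^{2^4}\gg(\delta_3\delta_4)^{2^{20}}N^5.$$ **Corollary 5.6.** There is an absolute constant $C>0$ such that the following holds. Let $q$ be a positive integer, $N\ge q$ real, $M=(N/q)^{1/2}$, let $\delta_2,\delta_3,\delta_4>0$ with $\delta_3<C\delta_2^3\delta_4^4$, and for each $b\in[\delta_2M]$ let $f_b:\mathbb Z\to\mathbb C$ be a $1$-bounded function supported in $[N]$. If $$\mathbb E_{b\in[\delta_2M]}\,\mathbb E_{a\in[\delta_2M]}\sum_{x,h_1,h_2\in\mathbb Z}\mu_{\delta_3,M}(h_1)\mu_{\delta_3,M}(h_2)\Delta_{2q(a+b)h_1,\,2qah_2}f_b(x)\ \ge\ \delta_4NM^2,$$ then $$\mathbb E_{u\in[q]}\,\mathbb E_{b\in[\delta_2M]}\|f_b\|_{U^4(u+q\mathbb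 Z)}^{2^4}\gg(\delta_3\delta_4)^{2^{21}}(N/q)^5.$$ -/

import Mathlib

open scoped BigOperators

noncomputable section

/-- The set `[t] = {n ∈ ℤ : 1 ≤ n ≤ t}`, for a real number `t`. -/
def initInterval (t : ℝ) : Finset ℤ := Finset.Icc 1 ⌊t⌋

/-- `f : ℤ → ℂ` is `1`-bounded. -/
def IsOneBounded (f : ℤ → ℂ) : Prop := ∀ x : ℤ, ‖f x‖ ≤ 1

/-- The Fejér-type weight `μ_{δ,M}(h) = #{(h₁, h₂) ∈ [δM]² : h₁ - h₂ = h} / (δ² M)`. -/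
def fejerWeight (δ M : ℝ) (h : ℤ) : ℝ :=
  (((initInterval (δ * M) ×ˢ initInterval (δ * M)).filter
    (fun p : ℤ × ℤ => p.1 - p.2 = h)).card : ℝ) / (δ ^ 2 * M)

/-- The multiplicative difference operator `Δ_h f(x) = f(x + h) * conj (f x)`. -/
def mulDiff (h : ℤ) (f : ℤ → ℂ) : ℤ → ℂ := fun x => f (x + h) * (starRingEnd ℂ) (f x)

/-- The iterated difference operator `Δ_{h₁,…,hₛ} f = Δ_{h₁} ⋯ Δ_{hₛ} f`. -/
def mulDiffs (hs : List ℤ) (f : ℤ → ℂ) : ℤ → ℂ := hs.foldr mulDiff f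

/-- The `U^s`-norm of a finitely supported `f : ℤ → ℂ`, normalized by
`‖f‖_{U^s}^{2^s} = ∑_{x, h₁, …, hₛ} Δ_{h₁,…,hₛ} f(x)`. For finitely supported `f` only finitely
many terms are nonzero (and the sum is a nonnegative real for `s ≥ 1`). -/
def gowersNorm (s : ℕ) (f : ℤ → ℂ) : ℝ :=
  (∑' p : ℤ × (Fin s → ℤ), mulDiffs (List.ofFn p.2) f p.1).re ^ ((1 : ℝ) / 2 ^ s)

/-- The `U^s`-norm localized to `T ⊆ ℤ`, that is `‖f 1_T‖_{U^s}`. -/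
def gowersNormOn (s : ℕ) (T : Set ℤ) (f : ℤ → ℂ) : ℝ := gowersNorm s (T.indicator f)

/-- The residue class `u + qℤ`. -/
def residueClass (q : ℕ) (u : ℤ) : Set ℤ := {x : ℤ | ∃ k : ℤ, x = u + q * k}

/-- The average of weighted box sums
`𝔼_{a ∈ [δM]} ∑_{x, h₁, h₂} μ_{δ',M}(h₁) μ_{δ',M}(h₂) Δ_{2q(a+b)h₁, 2qah₂} f(x)`
for finitely supported `f`. The sum has finitely many nonzero terms and its value is real. -/
def boxAverage (q : ℕ) (δ δ' M : ℝ) (b : ℤ) (f : ℤ → ℂ) : ℝ :=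
  (𝔼 a ∈ initInterval (δ * M), ∑' p : ℤ × ℤ × ℤ,
    (fejerWeight δ' M p.2.1 : ℂ) * (fejerWeight δ' M p.2.2 : ℂ) *
      mulDiffs [2 * q * (a + b) * p.2.1, 2 * q * a * p.2.2] f p.1).re

end

/-!
With `H = ⌊δ₃ M⌋`, the box average is an average over `a` of box sums along the progressions
`2 (a + b) [H]` and `2 a [H]`. Two rounds of Cauchy–Schwarz, one of them introducing a second
variable `a'`, bound it by box norms of `Δ_{d+d'} f`, where `d` and `d'` are differences of
`2 (a + b) [H]` and `2 (a' + b) [H]` and the box norm is taken along `2 a [H]` and `2 a' [H]`.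
For every `b` between `0` and the range of `a`, `gcd (a + b, a' + b)` is bounded for most pairs
`(a, a')`, and then no integer has many representations as `d + d'`; so `d + d'` may be replaced by
a free shift. The same counting with `b = 0`, after a further Cauchy–Schwarz in each of the two
remaining directions, frees these too and gives a lower bound for `‖f‖_{U³}`, hence for `‖f‖_{U⁴}`.

The counting requires the progressions not to be too short compared with `N`, at the density `θ` of
the box average. A density `θ` of order `(δ₃ δ₄)²` will do as long as `δ₄ δ₃²` is bounded, and it
is: otherwise most shifts move `[N]` off itself, and the box average is too small.

For a modulus `q`, rescaling the residue classes to `ℤ` turns the box average into an average of box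
averages with modulus `1`; a positive proportion of these must be large.
-/

open scoped ComplexConjugate

section CauchySchwarz

theorem norm_sum_mul_sq_le {ι : Type*} [Fintype ι] (u v : ι → ℂ) :
    ‖∑ i, u i * v i‖ ^ 2 ≤ (∑ i, ‖u i‖ ^ 2) * ∑ i, ‖v i‖ ^ 2 := by
  refine le_trans ?_ (Finset.sum_mul_sq_le_sq_mul_sq _ _ _)
  gcongr
  simpa only [norm_mul] using norm_sum_le Finset.univ fun i => u i * v i

theorem norm_sum_sq_le_card_mul {ι : Type*} [Fintype ι] (z : ι → ℂ) :
    ‖∑ i, z i‖ ^ 2 ≤ Fintype.card ι * ∑ i, ‖z i‖ ^ 2 := by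
  simpa using norm_sum_mul_sq_le 1 z

theorem ofReal_norm_sum_sq {ι : Type*} [Fintype ι] (z : ι → ℂ) :
    ((‖∑ i, z i‖ ^ 2 : ℝ) : ℂ) = ∑ i, ∑ j, z i * conj (z j) := by
  rw [← Complex.normSq_eq_norm_sq, ← Complex.mul_conj, map_sum, Finset.sum_mul_sum]

/-- The product of the four conjugated values of `m` at the vertices `(u, w)`, `(u, w')`,
`(u', w)`, `(u', w')` of a rectangle, as produced by doubling `w` and then `u`. -/
def rectProd {U W : Type*} (m : U → W → ℂ) (u u' : U) (w w' : W) : ℂ :=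
  m u w * conj (m u w') * conj (m u' w * conj (m u' w'))

theorem rectProd_mul {U W : Type*} (m n : U → W → ℂ) (u u' : U) (w w' : W) :
    rectProd (fun u w => m u w * n u w) u u' w w' =
      rectProd m u u' w w' * rectProd n u u' w w' := by
  simp only [rectProd, map_mul, Complex.conj_conj]
  ring

variable {Y T U V W : Type*} [Fintype Y] [Fintype T] [Fintype U] [Fintype V] [Fintype W]

theorem sum_sum_norm_sq_le_card_mul {a : Y → T → ℂ} {L : ℝ} (ha : ∀ t, ∑ y, ‖a y t‖ ^ 2 ≤ L) :
    ∑ y, ∑ t, ‖a y t‖ ^ 2 ≤ Fintype.card T * L := by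
  rw [Finset.sum_comm]
  simpa using Finset.sum_le_sum fun t (_ : t ∈ Finset.univ) => ha t

theorem norm_sum_sum_mul_sq_le {a : Y → T → ℂ} {L : ℝ} (ha : ∀ t, ∑ y, ‖a y t‖ ^ 2 ≤ L)
    (b : Y → T → ℂ) :
    ‖∑ y, ∑ t, a y t * b y t‖ ^ 2 ≤ Fintype.card T * L * ∑ y, ∑ t, ‖b y t‖ ^ 2 := by
  have h := norm_sum_mul_sq_le (fun p : Y × T => a p.1 p.2) (fun p => b p.1 p.2)
  simp only [Fintype.sum_prod_type] at h
  refine h.trans ?_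
  gcongr
  exact sum_sum_norm_sq_le_card_mul ha

theorem norm_sum_sq_le_doubling {a : Y → T → ℂ} {L : ℝ} (ha : ∀ t, ∑ y, ‖a y t‖ ^ 2 ≤ L)
    (z : Y → T → W → ℂ) :
    ‖∑ y, ∑ t, a y t * ∑ w, z y t w‖ ^ 2 ≤
      Fintype.card T * L * ‖∑ y, ∑ t, ∑ w, ∑ w', z y t w * conj (z y t w')‖ := by
  have h : ∑ y, ∑ t, ∑ w, ∑ w', z y t w * conj (z y t w')
      = ((∑ y, ∑ t, ‖∑ w, z y t w‖ ^ 2 : ℝ) : ℂ) := by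
    simp only [Complex.ofReal_sum, ofReal_norm_sum_sq]
  rw [h, Complex.norm_real, Real.norm_of_nonneg (by positivity)]
  exact norm_sum_sum_mul_sq_le ha _

theorem norm_box_sq_le_eliminate_first {A : Y → U → V → ℂ} {L : ℝ}
    (hA : ∀ u v, ∑ y, ‖A y u v‖ ^ 2 ≤ L) (Z : Y → U → V → W → ℂ) :
    ‖∑ y, ∑ u, ∑ v, ∑ w, A y u v * Z y u v w‖ ^ 2 ≤ Fintype.card U * Fintype.card V * L *
      ‖∑ y, ∑ v, ∑ w, ∑ w', ∑ u, Z y u v w * conj (Z y u v w')‖ := by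
  have h := norm_sum_sq_le_doubling (a := fun y (t : U × V) => A y t.1 t.2) (fun t => hA t.1 t.2)
    fun y t => Z y t.1 t.2
  simp only [Fintype.sum_prod_type, Finset.mul_sum, Fintype.card_prod, Nat.cast_mul] at h
  refine h.trans_eq ?_
  congr 2
  refine Finset.sum_congr rfl fun y _ => ?_
  refine Finset.sum_comm.trans (Finset.sum_congr rfl fun v _ => ?_)
  exact Finset.sum_comm.trans (Finset.sum_congr rfl fun w _ => Finset.sum_comm)

theorem norm_box_sq_le_eliminate_second {B : Y → V → W → ℂ} {L : ℝ}
    (hB : ∀ v w, ∑ y, ‖B y v w‖ ^ 2 ≤ L) (hB₁ : ∀ y v w, ‖B y v w‖ ≤ 1) (Z : Y → U → V → W → ℂ) :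
    ‖∑ y, ∑ v, ∑ w, ∑ w', ∑ u,
        B y v w * Z y u v w * conj (B y v w' * Z y u v w')‖ ^ 2 ≤
      Fintype.card V * Fintype.card W ^ 2 * L *
        ‖∑ y, ∑ w, ∑ w', ∑ u, ∑ u', ∑ v, rectProd (fun u w => Z y u v w) u u' w w'‖ := by
  have hBB : ∀ t : V × W × W, ∑ y, ‖B y t.1 t.2.1 * conj (B y t.1 t.2.2)‖ ^ 2 ≤ L := by
    intro t
    refine le_trans (Finset.sum_le_sum fun y _ => ?_) (hB t.1 t.2.1)
    rw [norm_mul, RCLike.norm_conj]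
    gcongr
    exact mul_le_of_le_one_right (norm_nonneg _) (hB₁ _ _ _)
  have h := norm_sum_sq_le_doubling hBB
    fun y t u => Z y u t.1 t.2.1 * conj (Z y u t.1 t.2.2)
  simp only [Fintype.sum_prod_type, Finset.mul_sum, Fintype.card_prod, Nat.cast_mul, Nat.cast_pow,
    ← sq] at h
  refine Eq.trans_le ?_ (h.trans_eq ?_)
  · simp only [map_mul, mul_mul_mul_comm]
  · congr 2
    refine Finset.sum_congr rfl fun y _ => ?_
    simp only [rectProd]
    refine Finset.sum_comm.trans (Finset.sum_congr rfl fun w _ => ?_)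
    refine Finset.sum_comm.trans (Finset.sum_congr rfl fun w' _ => ?_)
    refine Finset.sum_comm.trans (Finset.sum_congr rfl fun u _ => ?_)
    exact Finset.sum_comm

theorem norm_box_sq_le_eliminate_third {C : Y → U → W → ℂ} {L : ℝ}
    (hC : ∀ u w, ∑ y, ‖C y u w‖ ^ 2 ≤ L) (hC₁ : ∀ y u w, ‖C y u w‖ ≤ 1) (M : Y → U → V → W → ℂ) :
    ‖∑ y, ∑ w, ∑ w', ∑ u, ∑ u', ∑ v,
        rectProd (fun u w => C y u w * M y u v w) u u' w w'‖ ^ 2 ≤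
      Fintype.card U ^ 2 * Fintype.card W ^ 2 * L *
        ∑ y, ∑ w, ∑ w', ∑ u, ∑ u', ‖∑ v, rectProd (fun u w => M y u v w) u u' w w'‖ ^ 2 := by
  have hCC : ∀ t : W × W × U × U,
      ∑ y, ‖rectProd (C y) t.2.2.1 t.2.2.2 t.1 t.2.1‖ ^ 2 ≤ L := by
    intro t
    refine le_trans (Finset.sum_le_sum fun y _ => ?_) (hC t.2.2.1 t.1)
    simp only [rectProd, norm_mul, RCLike.norm_conj, mul_assoc]
    gcongr
    refine mul_le_of_le_one_right (norm_nonneg _) (mul_le_one₀ (hC₁ _ _ _) (by positivity) ?_)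
    exact mul_le_one₀ (hC₁ _ _ _) (norm_nonneg _) (hC₁ _ _ _)
  have h := norm_sum_sum_mul_sq_le hCC
    fun y t => ∑ v, rectProd (fun u w => M y u v w) t.2.2.1 t.2.2.2 t.1 t.2.1
  simp only [Fintype.sum_prod_type, Finset.mul_sum, Fintype.card_prod, Nat.cast_mul] at h
  simp only [rectProd_mul]
  refine h.trans_eq ?_
  simp only [← Finset.mul_sum]
  ring

/-- The Gowers–Cauchy–Schwarz inequality for three-variable boxes: the factors which depend on only
two of the variables are removed one at a time. -/
theorem norm_box_pow_eight_le {A : Y → U → V → ℂ} {B : Y → V → W → ℂ} {C : Y → U → W → ℂ} {L : ℝ}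
    (hA : ∀ u v, ∑ y, ‖A y u v‖ ^ 2 ≤ L) (hB : ∀ v w, ∑ y, ‖B y v w‖ ^ 2 ≤ L)
    (hB₁ : ∀ y v w, ‖B y v w‖ ≤ 1) (hC : ∀ u w, ∑ y, ‖C y u w‖ ^ 2 ≤ L)
    (hC₁ : ∀ y u w, ‖C y u w‖ ≤ 1) (M : Y → U → V → W → ℂ) :
    ‖∑ y, ∑ u, ∑ v, ∑ w, A y u v * (B y v w * (C y u w * M y u v w))‖ ^ 8 ≤
      L ^ 7 * (Fintype.card U * Fintype.card V * Fintype.card W) ^ 6 *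
        ∑ y, ∑ w, ∑ w', ∑ u, ∑ u', ‖∑ v, rectProd (fun u w => M y u v w) u u' w w'‖ ^ 2 := by
  have first := norm_box_sq_le_eliminate_first hA fun y u v w => B y v w * (C y u w * M y u v w)
  have second := norm_box_sq_le_eliminate_second hB hB₁ fun y u v w => C y u w * M y u v w
  have third := norm_box_sq_le_eliminate_third hC hC₁ M
  set T₁ := ∑ y, ∑ u, ∑ v, ∑ w, A y u v * (B y v w * (C y u w * M y u v w))
  set T₂ := ∑ y, ∑ v, ∑ w, ∑ w', ∑ u,
    B y v w * (C y u w * M y u v w) * conj (B y v w' * (C y u w' * M y u v w'))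
  set T₃ := ∑ y, ∑ w, ∑ w', ∑ u, ∑ u', ∑ v,
    rectProd (fun u w => C y u w * M y u v w) u u' w w'
  set Z := ∑ y, ∑ w, ∑ w', ∑ u, ∑ u', ‖∑ v, rectProd (fun u w => M y u v w) u u' w w'‖ ^ 2
  set m := (Fintype.card U : ℝ)
  set n := (Fintype.card V : ℝ)
  set r := (Fintype.card W : ℝ)
  calc ‖T₁‖ ^ 8 = (‖T₁‖ ^ 2) ^ 4 := by ring
    _ ≤ (m * n * L * ‖T₂‖) ^ 4 := by gcongr
    _ = (m * n * L) ^ 4 * (‖T₂‖ ^ 2) ^ 2 := by ring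
    _ ≤ (m * n * L) ^ 4 * (n * r ^ 2 * L * ‖T₃‖) ^ 2 := by gcongr
    _ = (m * n * L) ^ 4 * (n * r ^ 2 * L) ^ 2 * ‖T₃‖ ^ 2 := by ring
    _ ≤ (m * n * L) ^ 4 * (n * r ^ 2 * L) ^ 2 * (m ^ 2 * r ^ 2 * L * Z) := by gcongr
    _ = L ^ 7 * (m * n * r) ^ 6 * Z := by ring

end CauchySchwarz

section MulDeriv

variable {G : Type*}

/-- `f` is `1`-bounded and vanishes outside `I`. -/
structure IsBoundedOn (f : G → ℂ) (I : Finset G) : Prop where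
  norm_le : ∀ x, ‖f x‖ ≤ 1
  eq_zero : ∀ x ∉ I, f x = 0

variable {f : G → ℂ} {I : Finset G}

theorem IsBoundedOn.sum_norm_le [Fintype G] (hf : IsBoundedOn f I) : ∑ x, ‖f x‖ ≤ I.card := by
  rw [← Finset.sum_subset (Finset.subset_univ I) fun x _ hx => by simp [hf.eq_zero x hx]]
  simpa using Finset.sum_le_sum fun x (_ : x ∈ I) => hf.norm_le x

protected theorem IsBoundedOn.norm_sum_le [Fintype G] (hf : IsBoundedOn f I) :
    ‖∑ x, f x‖ ≤ I.card :=
  (norm_sum_le _ _).trans hf.sum_norm_le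

variable [AddCommGroup G]

/-- The multiplicative derivative `Δ_h f` of a function on an abelian group. -/
def mulDeriv (h : G) (f : G → ℂ) : G → ℂ := fun x => f (x + h) * conj (f x)

theorem mulDeriv_comm (d d' : G) (f : G → ℂ) :
    mulDeriv d (mulDeriv d' f) = mulDeriv d' (mulDeriv d f) := by
  funext x
  simp only [mulDeriv, map_mul, Complex.conj_conj, add_right_comm x d d']
  ring

theorem mulDeriv_zero (d : G) : mulDeriv d (0 : G → ℂ) = 0 := by
  funext x
  simp [mulDeriv]

theorem mulDeriv_sub_mulDeriv_sub (a b c d y : G) (f : G → ℂ) :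
    mulDeriv (a - b) (mulDeriv (c - d) f) (y + b + d) =
      f (y + a + c) * conj (f (y + a + d)) * conj (f (y + b + c) * conj (f (y + b + d))) := by
  have hac : y + b + d + (a - b) + (c - d) = y + a + c := by abel
  have had : y + b + d + (a - b) = y + a + d := by abel
  have hbc : y + b + d + (c - d) = y + b + c := by abel
  rw [mulDeriv, mulDeriv, mulDeriv, hac, had, hbc]

protected theorem IsBoundedOn.mulDeriv (hf : IsBoundedOn f I) (h : G) :
    IsBoundedOn (mulDeriv h f) I where
  norm_le x := by
    rw [mulDeriv, norm_mul, RCLike.norm_conj]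
    exact mul_le_one₀ (hf.norm_le _) (norm_nonneg _) (hf.norm_le _)
  eq_zero x hx := by simp [mulDeriv, hf.eq_zero x hx]

variable [Fintype G]

theorem sum_add_right {E : Type*} [AddCommMonoid E] (c : G) (g : G → E) :
    ∑ x, g (x + c) = ∑ x, g x :=
  Equiv.sum_comp (Equiv.addRight c) g

theorem IsBoundedOn.sum_norm_sq_add_mul_le (hf : IsBoundedOn f I) (c : G) {g : G → ℂ}
    (hg : ∀ x, ‖g x‖ ≤ 1) : ∑ x, ‖f (x + c) * g x‖ ^ 2 ≤ I.card := by
  refine le_trans ?_ hf.sum_norm_le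
  rw [← sum_add_right c fun x => ‖f x‖]
  gcongr with x
  rw [norm_mul]
  have hfg : ‖f (x + c)‖ * ‖g x‖ ≤ ‖f (x + c)‖ := mul_le_of_le_one_right (norm_nonneg _) (hg x)
  exact (sq_le (by positivity) (hfg.trans (hf.norm_le _))).trans hfg

theorem sum_sum_mulDeriv (g : G → ℂ) :
    ∑ h, ∑ x, mulDeriv h g x = ((‖∑ x, g x‖ ^ 2 : ℝ) : ℂ) := by
  rw [ofReal_norm_sum_sq, Finset.sum_comm, Finset.sum_comm (f := fun i j => g i * conj (g j))]
  refine Finset.sum_congr rfl fun x _ => ?_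
  simpa only [mulDeriv, add_comm x] using sum_add_right x fun i => g i * conj (g x)

theorem ofReal_sum_norm_sum_add_sq {σ : Type*} [Fintype σ] (r : σ → G) (g : G → ℂ) :
    ((∑ y, ‖∑ i, g (y + r i)‖ ^ 2 : ℝ) : ℂ) = ∑ i, ∑ j, ∑ y, mulDeriv (r i - r j) g y := by
  simp only [Complex.ofReal_sum, ofReal_norm_sum_sq]
  rw [Finset.sum_comm]
  refine Finset.sum_congr rfl fun i _ => ?_
  rw [Finset.sum_comm]
  refine Finset.sum_congr rfl fun j _ => ?_
  rw [← sum_add_right (r j) (mulDeriv (r i - r j) g)]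
  simp only [mulDeriv, add_assoc, add_sub_cancel]

/-- The squared modulus of the sum of the second multiplicative derivative `Δ_{d,d'} f`. -/
noncomputable def derivSumSq (f : G → ℂ) (d d' : G) : ℝ :=
  ‖∑ x, mulDeriv d (mulDeriv d' f) x‖ ^ 2

theorem derivSumSq_nonneg (f : G → ℂ) (d d' : G) : 0 ≤ derivSumSq f d d' := sq_nonneg _

theorem derivSumSq_comm (f : G → ℂ) (d d' : G) : derivSumSq f d d' = derivSumSq f d' d := by
  rw [derivSumSq, mulDeriv_comm, derivSumSq]

theorem IsBoundedOn.derivSumSq_le (hf : IsBoundedOn f I) (d d' : G) :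
    derivSumSq f d d' ≤ (I.card : ℝ) ^ 2 := by
  rw [derivSumSq]
  gcongr
  exact ((hf.mulDeriv d').mulDeriv d).norm_sum_le

end MulDeriv

section BoxForm

variable {G κ : Type*} [AddCommGroup G]

/-- The difference of the two entries of the family `p` selected by a pair of indices. -/
def shiftDiff (p : κ → G) (s : κ × κ) : G := p s.1 - p s.2

variable [Fintype G] [Fintype κ]

/-- The (unnormalized) box norm of `g` along the two families of shifts `q` and `q'`. -/
noncomputable def boxForm (q q' : κ → G) (g : G → ℂ) : ℝ :=
  ∑ s : κ × κ, ∑ y, ‖∑ l, mulDeriv (shiftDiff q s) g (y + q' l)‖ ^ 2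

theorem boxForm_nonneg (q q' : κ → G) (g : G → ℂ) : 0 ≤ boxForm q q' g := by
  unfold boxForm
  positivity

theorem IsBoundedOn.boxForm_le {g : G → ℂ} {I : Finset G} (hg : IsBoundedOn g I) (q q' : κ → G) :
    boxForm q q' g ≤ Fintype.card κ ^ 4 * I.card := by
  have inner : ∀ s : κ × κ, ∑ y, ‖∑ l, mulDeriv (shiftDiff q s) g (y + q' l)‖ ^ 2 ≤
      Fintype.card κ ^ 2 * I.card := fun s => calc
    _ ≤ ∑ y, Fintype.card κ * ∑ l, ‖mulDeriv (shiftDiff q s) g (y + q' l)‖ ^ 2 := by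
        gcongr
        exact norm_sum_sq_le_card_mul _
    _ = Fintype.card κ * ∑ l, ∑ y, ‖mulDeriv (shiftDiff q s) g (y + q' l) * 1‖ ^ 2 := by
        rw [← Finset.mul_sum, Finset.sum_comm]
        simp only [mul_one]
    _ ≤ Fintype.card κ * ∑ _ : κ, (I.card : ℝ) := by
        gcongr
        exact (hg.mulDeriv _).sum_norm_sq_add_mul_le (g := 1) _ fun x => by simp
    _ = Fintype.card κ ^ 2 * I.card := by
        rw [Finset.sum_const, Finset.card_univ, nsmul_eq_mul]
        ring
  calc boxForm q q' g ≤ ∑ _ : κ × κ, (Fintype.card κ ^ 2 * I.card : ℝ) :=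
        Finset.sum_le_sum fun s _ => inner s
    _ = Fintype.card κ ^ 4 * I.card := by
        rw [Finset.sum_const, Finset.card_univ, Fintype.card_prod, nsmul_eq_mul]
        push_cast
        ring

theorem ofReal_boxForm (q q' : κ → G) (g : G → ℂ) :
    (boxForm q q' g : ℂ) = ∑ s : κ × κ, ∑ t : κ × κ, ∑ y,
      mulDeriv (shiftDiff q' t) (mulDeriv (shiftDiff q s) g) y := by
  rw [boxForm, Complex.ofReal_sum]
  simp only [ofReal_sum_norm_sum_add_sq, Fintype.sum_prod_type, shiftDiff]

theorem sum_boxForm_mulDeriv (q q' : κ → G) (f : G → ℂ) :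
    ∑ h, boxForm q q' (mulDeriv h f) =
      ∑ s : κ × κ, ∑ t : κ × κ, derivSumSq f (shiftDiff q s) (shiftDiff q' t) := by
  rw [← Complex.ofReal_inj]
  simp only [Complex.ofReal_sum, ofReal_boxForm]
  rw [Finset.sum_comm]
  refine Finset.sum_congr rfl fun s _ => ?_
  rw [Finset.sum_comm]
  refine Finset.sum_congr rfl fun t _ => ?_
  rw [derivSumSq, ← sum_sum_mulDeriv, mulDeriv_comm (shiftDiff q s)]
  refine Finset.sum_congr rfl fun h _ => Finset.sum_congr rfl fun x _ => ?_
  rw [mulDeriv_comm (shiftDiff q s), mulDeriv_comm (shiftDiff q' t)]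

variable {U : Type*} (q q' : κ → G) (r : U → G) (f : G → ℂ)

theorem sum_norm_sq_rectProd (u u' : U) :
    ∑ y, ∑ w, ∑ w', ‖∑ v, rectProd (fun u w => conj (f (y + q' v + q w + r u))) u u' w w'‖ ^ 2 =
      boxForm q q' (mulDeriv (r u - r u') f) := by
  rw [boxForm, Fintype.sum_prod_type]
  refine Finset.sum_comm.trans (Finset.sum_congr rfl fun w _ => ?_)
  refine Finset.sum_comm.trans (Finset.sum_congr rfl fun w' _ => ?_)
  refine Eq.trans (Finset.sum_congr rfl fun y _ => ?_) (sum_add_right (q w' + r u') _)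
  rw [← RCLike.norm_conj, map_sum]
  congr 2
  refine Finset.sum_congr rfl fun v _ => ?_
  have shift : y + (q w' + r u') + q' v = y + q' v + q w' + r u' := by abel
  rw [shift, shiftDiff, mulDeriv_sub_mulDeriv_sub]
  simp only [rectProd, map_mul, Complex.conj_conj]
  ring

theorem norm_box_pow_eight_le_boxForm [Fintype U] {L : ℝ} {A : G → U → κ → ℂ} {B : G → κ → κ → ℂ}
    {C : G → U → κ → ℂ} (hA : ∀ u v, ∑ y, ‖A y u v‖ ^ 2 ≤ L) (hB : ∀ v w, ∑ y, ‖B y v w‖ ^ 2 ≤ L)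
    (hB₁ : ∀ y v w, ‖B y v w‖ ≤ 1) (hC : ∀ u w, ∑ y, ‖C y u w‖ ^ 2 ≤ L)
    (hC₁ : ∀ y u w, ‖C y u w‖ ≤ 1) :
    ‖∑ y, ∑ u, ∑ v, ∑ w, A y u v * (B y v w * (C y u w * conj (f (y + q' v + q w + r u))))‖ ^ 8 ≤
      L ^ 7 * (Fintype.card U * Fintype.card κ ^ 2) ^ 6 *
        ∑ u, ∑ u', boxForm q q' (mulDeriv (r u - r u') f) := by
  refine (norm_box_pow_eight_le hA hB hB₁ hC hC₁ _).trans_eq ?_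
  have swap := Finset.sum_comm (s := Finset.univ) (t := Finset.univ)
    (f := fun (p : G × κ × κ) (t : U × U) => ‖∑ v, rectProd
      (fun u w => conj (f (p.1 + q' v + q w + r u))) t.1 t.2 p.2.1 p.2.2‖ ^ 2)
  simp only [Fintype.sum_prod_type, sum_norm_sq_rectProd] at swap
  rw [swap]
  ring

end BoxForm

section FamilyBoxSum

theorem norm_sum_pow_le_card_pow_mul {σ : Type*} [Fintype σ] (z : σ → ℂ) (n : ℕ) :
    ‖∑ i, z i‖ ^ (n + 1) ≤ Fintype.card σ ^ n * ∑ i, ‖z i‖ ^ (n + 1) :=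
  (pow_le_pow_left₀ (norm_nonneg _) (norm_sum_le _ _) _).trans
    (pow_sum_le_card_mul_sum_pow (fun _ _ => norm_nonneg _) n)

variable {G ι κ : Type*} [AddCommGroup G] [Fintype G] [Fintype ι] [Fintype κ]

/-- The sum of the box sums `∑ Δ_{h,h'} f(x)` over `a`, where `h` and `h'` range over the
differences of the families `p a` and `q a`. -/
def familyBoxSum (p q : ι → κ → G) (f : G → ℂ) : ℂ :=
  ∑ a, ∑ s : κ × κ, ∑ t : κ × κ, ∑ x,
    mulDeriv (shiftDiff (p a) s) (mulDeriv (shiftDiff (q a) t) f) x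

/-- The dual function of a box sum: the box sum is the pairing of `f` with it. -/
def dualFun (p q : κ → G) (f : G → ℂ) (x : G) : ℂ :=
  ∑ s : κ × κ, ∑ t : κ × κ, f (x + shiftDiff p s + shiftDiff q t) *
    conj (f (x + shiftDiff p s)) * conj (f (x + shiftDiff q t))

theorem familyBoxSum_eq_sum_mul_dualFun (p q : ι → κ → G) (f : G → ℂ) :
    familyBoxSum p q f = ∑ x, f x * ∑ a, dualFun (p a) (q a) f x := by
  simp only [familyBoxSum, dualFun, Finset.mul_sum]
  refine Eq.symm (Finset.sum_comm.trans (Finset.sum_congr rfl fun a _ => ?_))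
  refine Finset.sum_comm.trans (Finset.sum_congr rfl fun s _ => ?_)
  refine Finset.sum_comm.trans (Finset.sum_congr rfl fun t _ => Finset.sum_congr rfl fun x _ => ?_)
  simp only [mulDeriv, map_mul, Complex.conj_conj]
  ring

/-- The part of the pairing of the dual functions of `(p, q)` and `(p', q')` in which four of the
eight shifts are fixed at `c`, `e`, `c'` and `e'`. -/
def pairingSum (p q p' q' : κ → G) (f : G → ℂ) (c e c' e' : G) : ℂ :=
  ∑ y, ∑ u : κ × κ, ∑ v, ∑ w,
    f (y + (p u.1 + p' u.2 + e + q' v)) * conj (f (y + (c + p' u.2 + e + q' v))) *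
    (f (y + (c + c' + q w + q' v)) * conj (f (y + (c + c' + q w + e'))) *
    (f (y + (c + p' u.2 + q w + e')) * conj (f (y + q' v + q w + (p u.1 + p' u.2)))))

theorem sum_dualFun_mul_conj (p q p' q' : κ → G) (f : G → ℂ) :
    ∑ x, dualFun p q f x * conj (dualFun p' q' f x) =
      ∑ r : κ × κ × κ × κ, pairingSum p q p' q' f (p r.1) (q r.2.1) (p' r.2.2.1) (q' r.2.2.2) := by
  let E (p q : κ → G) (r : (κ × κ) × κ × κ) (x : G) : ℂ :=
    f (x + shiftDiff p r.1 + shiftDiff q r.2) * conj (f (x + shiftDiff p r.1)) *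
      conj (f (x + shiftDiff q r.2))
  calc _ = ∑ r : ((κ × κ) × κ × κ) × (κ × κ) × κ × κ, ∑ x, E p q r.1 x * conj (E p' q' r.2 x) := by
        rw [Finset.sum_comm]
        simp only [dualFun, ← Fintype.sum_prod_type', map_sum, Finset.sum_mul_sum, E]
    _ = ∑ r : ((κ × κ) × κ × κ) × (κ × κ) × κ × κ, ∑ y,
          E p q r.1 (y + (p r.1.1.2 + q r.1.2.2 + p' r.2.1.2 + q' r.2.2.2)) *
          conj (E p' q' r.2 (y + (p r.1.1.2 + q r.1.2.2 + p' r.2.1.2 + q' r.2.2.2))) :=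
        Finset.sum_congr rfl fun r _ => (sum_add_right _ _).symm
    _ = _ := by
        simp only [pairingSum, ← Fintype.sum_prod_type']
        refine Fintype.sum_equiv
          ⟨fun ⟨⟨⟨⟨i', i⟩, j', j⟩, ⟨k', k⟩, l', l⟩, y⟩ => ⟨⟨i, j', k', l'⟩, y, ⟨i', k⟩, l, j⟩,
            fun ⟨⟨i, j', k', l'⟩, y, ⟨i', k⟩, l, j⟩ => ⟨⟨⟨⟨i', i⟩, j', j⟩, ⟨k', k⟩, l', l⟩, y⟩,
            fun _ => rfl, fun _ => rfl⟩ _ _ ?_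
        rintro ⟨⟨⟨⟨i', i⟩, j', j⟩, ⟨k', k⟩, l', l⟩, y⟩
        simp only [E, shiftDiff, Equiv.coe_fn_mk, map_mul, Complex.conj_conj]
        have hij : y + (p i + q j + p' k + q' l) + (p i' - p i) + (q j' - q j)
          = y + (p i' + p' k + q j' + q' l) := by abel
        have hi : y + (p i + q j + p' k + q' l) + (p i' - p i)
          = y + q' l + q j + (p i' + p' k) := by abel
        have hj : y + (p i + q j + p' k + q' l) + (q j' - q j)
          = y + (p i + p' k + q j' + q' l) := by abel
        have hkl : y + (p i + q j + p' k + q' l) + (p' k' - p' k) + (q' l' - q' l)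
          = y + (p i + p' k' + q j + q' l') := by abel
        have hk : y + (p i + q j + p' k + q' l) + (p' k' - p' k)
          = y + (p i + p' k' + q j + q' l) := by abel
        have hl : y + (p i + q j + p' k + q' l) + (q' l' - q' l)
          = y + (p i + p' k + q j + q' l') := by abel
        rw [hij, hi, hj, hkl, hk, hl]
        ring

/-- The sum, over the differences `d` of `p` and `d'` of `p'`, of the box norms of `Δ_{d+d'} f`
along `q` and `q'`. -/
noncomputable def boxFormSum (p q p' q' : κ → G) (f : G → ℂ) : ℝ :=
  ∑ s : κ × κ, ∑ t : κ × κ, boxForm q q' (mulDeriv (shiftDiff p s + shiftDiff p' t) f)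

theorem boxFormSum_nonneg (p q p' q' : κ → G) (f : G → ℂ) : 0 ≤ boxFormSum p q p' q' f :=
  Finset.sum_nonneg fun _ _ => Finset.sum_nonneg fun _ _ => boxForm_nonneg _ _ _

variable {f : G → ℂ} {I : Finset G}

theorem IsBoundedOn.norm_pairingSum_pow_eight_le (hf : IsBoundedOn f I) (p q p' q' : κ → G)
    (c e c' e' : G) :
    ‖pairingSum p q p' q' f c e c' e'‖ ^ 8 ≤ I.card ^ 7 * Fintype.card κ ^ 24 *
      boxFormSum p q p' q' f := by
  have hconj : ∀ x, ‖conj (f x)‖ ≤ 1 := fun x => (RCLike.norm_conj _).trans_le (hf.norm_le x)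
  refine (norm_box_pow_eight_le_boxForm q q' (fun u : κ × κ => p u.1 + p' u.2) f (L := I.card)
    (fun u v => hf.sum_norm_sq_add_mul_le _ fun x => hconj _)
    (fun v w => hf.sum_norm_sq_add_mul_le _ fun x => hconj _) (fun y v w => ?_)
    (fun u w => ?_) fun y u w => hf.norm_le _).trans_eq ?_
  · rw [norm_mul]
    exact mul_le_one₀ (hf.norm_le _) (norm_nonneg _) (hconj _)
  · simpa using hf.sum_norm_sq_add_mul_le (c + p' u.2 + q w + e') (g := 1) fun x => by simp
  · simp only [boxFormSum, shiftDiff, Fintype.card_prod, Fintype.sum_prod_type, add_sub_add_comm]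
    rw [Finset.sum_congr rfl fun i _ => Finset.sum_comm]
    push_cast
    ring

theorem IsBoundedOn.norm_sum_dualFun_pow_eight_le (hf : IsBoundedOn f I) (p q p' q' : κ → G) :
    ‖∑ x, dualFun p q f x * conj (dualFun p' q' f x)‖ ^ 8 ≤
      I.card ^ 7 * Fintype.card κ ^ 56 * boxFormSum p q p' q' f := by
  rw [sum_dualFun_mul_conj]
  calc _ ≤ Fintype.card (κ × κ × κ × κ) ^ 7 * ∑ r : κ × κ × κ × κ,
        ‖pairingSum p q p' q' f (p r.1) (q r.2.1) (p' r.2.2.1) (q' r.2.2.2)‖ ^ 8 :=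
        norm_sum_pow_le_card_pow_mul _ 7
    _ ≤ Fintype.card (κ × κ × κ × κ) ^ 7 * ∑ _ : κ × κ × κ × κ,
        (I.card ^ 7 * Fintype.card κ ^ 24 * boxFormSum p q p' q' f : ℝ) := by
        gcongr
        exact hf.norm_pairingSum_pow_eight_le p q p' q' _ _ _ _
    _ = _ := by
        simp only [Finset.sum_const, Finset.card_univ, Fintype.card_prod, nsmul_eq_mul]
        push_cast
        ring

theorem IsBoundedOn.norm_familyBoxSum_sq_le (hf : IsBoundedOn f I) (p q : ι → κ → G) :
    ‖familyBoxSum p q f‖ ^ 2 ≤ I.card *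
      ‖∑ t : ι × ι, ∑ x,
        dualFun (p t.1) (q t.1) f x * conj (dualFun (p t.2) (q t.2) f x)‖ := by
  have expand : ∑ t : ι × ι, ∑ x,
      dualFun (p t.1) (q t.1) f x * conj (dualFun (p t.2) (q t.2) f x) =
        ((∑ x, ‖∑ a, dualFun (p a) (q a) f x‖ ^ 2 : ℝ) : ℂ) := by
    rw [Finset.sum_comm]
    simp only [Complex.ofReal_sum, ofReal_norm_sum_sq, Fintype.sum_prod_type]
  rw [expand, Complex.norm_real, Real.norm_of_nonneg (by positivity),
    familyBoxSum_eq_sum_mul_dualFun]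
  refine (norm_sum_mul_sq_le _ _).trans ?_
  gcongr
  simpa using hf.sum_norm_sq_add_mul_le 0 (g := 1) fun x => by simp

theorem IsBoundedOn.norm_familyBoxSum_pow_sixteen_le (hf : IsBoundedOn f I) (p q : ι → κ → G) :
    ‖familyBoxSum p q f‖ ^ 16 ≤ I.card ^ 15 * Fintype.card ι ^ 14 * Fintype.card κ ^ 56 *
      ∑ a, ∑ a', boxFormSum (p a) (q a) (p a') (q a') f := by
  let z (t : ι × ι) : ℂ := ∑ x, dualFun (p t.1) (q t.1) f x * conj (dualFun (p t.2) (q t.2) f x)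
  calc ‖familyBoxSum p q f‖ ^ 16 = (‖familyBoxSum p q f‖ ^ 2) ^ 8 := by ring
    _ ≤ (I.card * ‖∑ t, z t‖) ^ 8 := by
        gcongr
        exact hf.norm_familyBoxSum_sq_le p q
    _ = I.card ^ 8 * ‖∑ t, z t‖ ^ 8 := by ring
    _ ≤ I.card ^ 8 * (Fintype.card (ι × ι) ^ 7 * ∑ t, ‖z t‖ ^ 8) := by
        gcongr
        exact norm_sum_pow_le_card_pow_mul z 7
    _ ≤ I.card ^ 8 * (Fintype.card (ι × ι) ^ 7 * ∑ t : ι × ι,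
          I.card ^ 7 * Fintype.card κ ^ 56 * boxFormSum (p t.1) (q t.1) (p t.2) (q t.2) f) := by
        gcongr with t
        exact hf.norm_sum_dualFun_pow_eight_le _ _ _ _
    _ = _ := by
        rw [← Finset.mul_sum, Fintype.card_prod, Fintype.sum_prod_type]
        push_cast
        ring

end FamilyBoxSum

section Concatenation

theorem sum_comp_le_of_card_fiber_le {σ H : Type*} [Fintype σ] [Fintype H]
    [DecidableEq H] (r : σ → H) {R : ℝ}
    (hR : ∀ h, ((Finset.univ.filter fun i => r i = h).card : ℝ) ≤ R) {w : H → ℝ}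
    (hw : ∀ h, 0 ≤ w h) : ∑ i, w (r i) ≤ R * ∑ h, w h := by
  rw [← Finset.sum_fiberwise Finset.univ r, Finset.mul_sum]
  refine Finset.sum_le_sum fun h _ => ?_
  calc ∑ i with r i = h, w (r i) = (Finset.univ.filter fun i => r i = h).card * w h := by
        rw [← nsmul_eq_mul, ← Finset.sum_const]
        exact Finset.sum_congr rfl fun i hi => by rw [(Finset.mem_filter.1 hi).2]
    _ ≤ R * w h := by
        gcongr
        exacts [hw h, hR h]

variable {G ι κ : Type*} [AddCommGroup G] [Fintype ι] [Fintype κ]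

/-- Quantitative equidistribution of the differences of the family `p`: outside a proportion `η` of
the pairs `t`, no `h` has more than `R η` representations as a sum of a difference of `p t.1` and a
difference of `p t.2`. -/
def HasFewReps [DecidableEq G] (p : ι → κ → G) (R : ℝ → ℝ) : Prop :=
  ∀ η : ℝ, 0 < η → η ≤ 1 → ∃ bad : Finset (ι × ι), (bad.card : ℝ) ≤ η * Fintype.card ι ^ 2 ∧
    ∀ t ∉ bad, ∀ h : G, (((Finset.univ : Finset ((κ × κ) × (κ × κ))).filter fun st =>
      shiftDiff (p t.1) st.1 + shiftDiff (p t.2) st.2 = h).card : ℝ) ≤ R η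

theorem sum_comp_shiftDiff_sub (q : ι → κ → G) (w : G → ℝ) :
    ∑ i : ι × κ × κ, ∑ j : ι × κ × κ, w (shiftDiff (q i.1) i.2 - shiftDiff (q j.1) j.2) =
      ∑ t : ι × ι, ∑ st : (κ × κ) × (κ × κ),
        w (shiftDiff (q t.1) st.1 + shiftDiff (q t.2) st.2) := by
  rw [← Fintype.sum_prod_type', ← Fintype.sum_prod_type']
  refine Fintype.sum_equiv ((Equiv.prodProdProdComm _ _ _ _).trans
    (Equiv.prodCongr (.refl _) (Equiv.prodCongr (.refl _) (Equiv.prodComm _ _)))) _ _ fun x => ?_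
  simp [shiftDiff, sub_eq_add_neg]

variable [Fintype G]

theorem HasFewReps.sum_le [DecidableEq G] {p : ι → κ → G} {R : ℝ → ℝ} (hp : HasFewReps p R)
    {η : ℝ} (hη : 0 < η) (hη1 : η ≤ 1) (hR : 0 ≤ R η) {w : ι × ι → G → ℝ} {B : ℝ} (hB : 0 ≤ B)
    (hw : ∀ t h, 0 ≤ w t h) (hwB : ∀ t h, w t h ≤ B) :
    ∑ t : ι × ι, ∑ st : (κ × κ) × (κ × κ),
        w t (shiftDiff (p t.1) st.1 + shiftDiff (p t.2) st.2) ≤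
      η * Fintype.card ι ^ 2 * Fintype.card κ ^ 4 * B + R η * ∑ t, ∑ h, w t h := by
  classical
  obtain ⟨bad, hbad, hgood⟩ := hp η hη hη1
  rw [← Finset.sum_add_sum_compl bad]
  gcongr ?_ + ?_
  · calc _ ≤ ∑ _ ∈ bad, (Fintype.card κ ^ 4 * B : ℝ) := by
          gcongr with t
          refine (Finset.sum_le_sum fun st _ => hwB t _).trans_eq ?_
          simp only [Finset.sum_const, Finset.card_univ, Fintype.card_prod, nsmul_eq_mul]
          push_cast
          ring
      _ = bad.card * (Fintype.card κ ^ 4 * B) := by rw [Finset.sum_const, nsmul_eq_mul]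
      _ ≤ η * Fintype.card ι ^ 2 * (Fintype.card κ ^ 4 * B) := by gcongr
      _ = _ := by ring
  · calc _ ≤ ∑ t ∈ badᶜ, R η * ∑ h, w t h := Finset.sum_le_sum fun t ht =>
          sum_comp_le_of_card_fiber_le _ (hgood t (Finset.mem_compl.1 ht)) (hw t)
      _ ≤ ∑ t, R η * ∑ h, w t h :=
          Finset.sum_le_sum_of_subset_of_nonneg (Finset.subset_univ _) fun t _ _ =>
            mul_nonneg hR (Finset.sum_nonneg fun h _ => hw t h)
      _ = _ := by rw [← Finset.mul_sum]

variable {f : G → ℂ} {I D : Finset G} {L θ : ℝ}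

theorem ofReal_derivSumSq (f : G → ℂ) (d d' : G) :
    (derivSumSq f d d' : ℂ) = ∑ h, ∑ y, mulDeriv d (mulDeriv h (mulDeriv d' f)) y := by
  rw [derivSumSq, ← sum_sum_mulDeriv]
  simp only [mulDeriv_comm d]

theorem sum_derivSumSq_eq_sum_of_mulDeriv_eq_zero (hD : ∀ h ∉ D, mulDeriv h f = 0) (d : G) :
    ∑ d' ∈ D, derivSumSq f d d' = ∑ d', derivSumSq f d d' :=
  Finset.sum_subset (Finset.subset_univ D) fun d' _ hd' => by
    simp [derivSumSq, hD d' hd', mulDeriv_zero]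

theorem norm_sum_sum_mulDeriv_sq_le {σ : Type*} [Fintype σ] (r : σ → G) (g : G → ℂ) :
    ‖∑ i, ∑ y, mulDeriv (r i) g y‖ ^ 2 ≤
      (∑ y, ‖g y‖ ^ 2) * ∑ y, ‖∑ i, g (y + r i)‖ ^ 2 := by
  have expand : ∑ i, ∑ y, mulDeriv (r i) g y = ∑ y, conj (g y) * ∑ i, g (y + r i) := by
    simp only [mulDeriv, Finset.mul_sum]
    rw [Finset.sum_comm]
    exact Finset.sum_congr rfl fun y _ => Finset.sum_congr rfl fun i _ => mul_comm _ _
  rw [expand]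
  simpa only [RCLike.norm_conj] using norm_sum_mul_sq_le (fun y => conj (g y)) _

theorem IsBoundedOn.sq_sum_derivSumSq_le (hf : IsBoundedOn f I)
    (hD : ∀ h ∉ D, mulDeriv h f = 0) {σ : Type*} [Fintype σ] (r : σ → G) (d' : G) :
    (∑ i, derivSumSq f (r i) d') ^ 2 ≤
      D.card * I.card * ∑ i, ∑ j, derivSumSq f (r i - r j) d' := by
  let g : G → G → ℂ := fun h => mulDeriv h (mulDeriv d' f)
  let Y : G → ℂ := fun h => ∑ i, ∑ y, mulDeriv (r i) (g h) y
  let Z : G → ℝ := fun h => ∑ y, ‖∑ i, g h (y + r i)‖ ^ 2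
  have sum_Y : ((∑ i, derivSumSq f (r i) d' : ℝ) : ℂ) = ∑ h ∈ D, Y h := by
    have hY (h : G) (hh : h ∉ D) : Y h = 0 := by
      have hg : g h = 0 := by rw [← mulDeriv_zero d', ← hD h hh, mulDeriv_comm d' h]
      simp [Y, hg, mulDeriv_zero]
    rw [Finset.sum_subset (Finset.subset_univ D) fun h _ => hY h, Complex.ofReal_sum]
    simp only [ofReal_derivSumSq]
    exact Finset.sum_comm
  have Y_le (h : G) : ‖Y h‖ ^ 2 ≤ I.card * Z h := by
    refine (norm_sum_sum_mulDeriv_sq_le r (g h)).trans ?_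
    gcongr
    simpa using ((hf.mulDeriv d').mulDeriv h).sum_norm_sq_add_mul_le 0 (g := 1) (by simp)
  have sum_Z : ∑ h, Z h = ∑ i, ∑ j, derivSumSq f (r i - r j) d' := by
    have ofReal_Z (h : G) : (Z h : ℂ) = ∑ i, ∑ j, ∑ y, mulDeriv (r i - r j) (g h) y :=
      ofReal_sum_norm_sum_add_sq r (g h)
    rw [← Complex.ofReal_inj]
    simp only [Complex.ofReal_sum, ofReal_Z, ofReal_derivSumSq]
    rw [Finset.sum_comm]
    exact Finset.sum_congr rfl fun i _ => Finset.sum_comm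
  calc (∑ i, derivSumSq f (r i) d') ^ 2 = ‖∑ h ∈ D, Y h‖ ^ 2 := by
        rw [← sum_Y, Complex.norm_real, Real.norm_eq_abs, sq_abs]
    _ ≤ (∑ h ∈ D, ‖Y h‖) ^ 2 := by
        gcongr
        exact norm_sum_le _ _
    _ ≤ D.card * ∑ h ∈ D, ‖Y h‖ ^ 2 := sq_sum_le_card_mul_sum_sq
    _ ≤ D.card * ∑ h ∈ D, I.card * Z h := by
        gcongr with h
        exact Y_le h
    _ ≤ D.card * ∑ h, I.card * Z h := by
        gcongr
        exact Finset.subset_univ D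
    _ = _ := by
        rw [← Finset.mul_sum, sum_Z]
        ring

theorem IsBoundedOn.sq_sum_derivSumSq_family_le [DecidableEq G] (hf : IsBoundedOn f I)
    (hL : I.card ≤ L) (hD : ∀ h ∉ D, mulDeriv h f = 0) (hDL : D.card ≤ 2 * L) {q : ι → κ → G}
    {R : ℝ → ℝ} (hq : HasFewReps q R) {η : ℝ} (hη : 0 < η) (hη1 : η ≤ 1) (hR : 0 ≤ R η) (d' : G) :
    (∑ i : ι × κ × κ, derivSumSq f (shiftDiff (q i.1) i.2) d') ^ 2 ≤
      2 * L ^ 2 * (η * Fintype.card ι ^ 2 * Fintype.card κ ^ 4 * L ^ 2 +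
        R η * Fintype.card ι ^ 2 * ∑ d, derivSumSq f d d') := by
  have hL0 : 0 ≤ L := (Nat.cast_nonneg _).trans hL
  calc _ ≤ D.card * I.card * ∑ i : ι × κ × κ, ∑ j : ι × κ × κ,
        derivSumSq f (shiftDiff (q i.1) i.2 - shiftDiff (q j.1) j.2) d' :=
        hf.sq_sum_derivSumSq_le hD (fun i : ι × κ × κ => shiftDiff (q i.1) i.2) d'
    _ = D.card * I.card * ∑ t : ι × ι, ∑ st : (κ × κ) × (κ × κ),
        derivSumSq f (shiftDiff (q t.1) st.1 + shiftDiff (q t.2) st.2) d' := by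
        rw [sum_comp_shiftDiff_sub q fun h => derivSumSq f h d']
    _ ≤ D.card * I.card * (η * Fintype.card ι ^ 2 * Fintype.card κ ^ 4 * (I.card : ℝ) ^ 2 +
        R η * ∑ _ : ι × ι, ∑ d, derivSumSq f d d') := by
        gcongr
        exact hq.sum_le hη hη1 hR (w := fun _ h => derivSumSq f h d') (by positivity)
          (fun _ _ => derivSumSq_nonneg _ _ _) fun _ _ => hf.derivSumSq_le _ _
    _ ≤ 2 * L * L * (η * Fintype.card ι ^ 2 * Fintype.card κ ^ 4 * L ^ 2 +
        R η * ∑ _ : ι × ι, ∑ d, derivSumSq f d d') := by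
        gcongr
        exact add_nonneg (by positivity) (mul_nonneg hR (Finset.sum_nonneg fun _ _ =>
          Finset.sum_nonneg fun _ _ => derivSumSq_nonneg _ _ _))
    _ = _ := by
        simp only [Finset.sum_const, Finset.card_univ, Fintype.card_prod, nsmul_eq_mul]
        push_cast
        ring

theorem IsBoundedOn.sq_sum_sum_derivSumSq_family_le [DecidableEq G] (hf : IsBoundedOn f I)
    (hL : I.card ≤ L) (hD : ∀ h ∉ D, mulDeriv h f = 0) (hDL : D.card ≤ 2 * L) {q : ι → κ → G}
    {R : ℝ → ℝ} (hq : HasFewReps q R) {η : ℝ} (hη : 0 < η) (hη1 : η ≤ 1) (hR : 0 ≤ R η)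
    {ε : Type*} (E : Finset ε) (d : ε → G) {m : ℝ} (hE : E.card ≤ m) :
    (∑ e ∈ E, ∑ i : ι × κ × κ, derivSumSq f (shiftDiff (q i.1) i.2) (d e)) ^ 2 ≤
      m * (2 * L ^ 2 * (m * (η * Fintype.card ι ^ 2 * Fintype.card κ ^ 4 * L ^ 2) +
        R η * Fintype.card ι ^ 2 * ∑ e ∈ E, ∑ d', derivSumSq f d' (d e))) := calc
  _ ≤ E.card * ∑ e ∈ E, (∑ i : ι × κ × κ, derivSumSq f (shiftDiff (q i.1) i.2) (d e)) ^ 2 :=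
      sq_sum_le_card_mul_sum_sq
  _ ≤ E.card * ∑ e ∈ E, 2 * L ^ 2 * (η * Fintype.card ι ^ 2 * Fintype.card κ ^ 4 * L ^ 2 +
        R η * Fintype.card ι ^ 2 * ∑ d', derivSumSq f d' (d e)) := by
      gcongr with e
      exact hf.sq_sum_derivSumSq_family_le hL hD hDL hq hη hη1 hR (d e)
  _ = E.card * (2 * L ^ 2 * (E.card * (η * Fintype.card ι ^ 2 * Fintype.card κ ^ 4 * L ^ 2) +
        R η * Fintype.card ι ^ 2 * ∑ e ∈ E, ∑ d', derivSumSq f d' (d e))) := by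
      rw [← Finset.mul_sum, Finset.sum_add_distrib, Finset.sum_const, nsmul_eq_mul,
        ← Finset.mul_sum]
  _ ≤ _ := by
      have _ : 0 ≤ m := (Nat.cast_nonneg _).trans hE
      have hW : 0 ≤ ∑ e ∈ E, ∑ d', derivSumSq f d' (d e) :=
        Finset.sum_nonneg fun _ _ => Finset.sum_nonneg fun _ _ => derivSumSq_nonneg _ _ _
      gcongr

theorem mul_pow_succ_le (hθ : 0 < θ) (hθ1 : θ ≤ 1 / 1000) (n : ℕ) :
    1000 * θ ^ (n + 1) ≤ θ ^ n := by
  rw [pow_succ]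
  nlinarith [pow_pos hθ n]

theorem pow_succ_mul_le_of_le_add {P Q : ℝ} (hθ : 0 < θ) (hθ1 : θ ≤ 1 / 1000) (hP : 0 ≤ P) (n : ℕ)
    (h : θ ^ n * P ≤ 8 * θ ^ (n + 1) * P + Q) : θ ^ (n + 1) * P ≤ Q := by
  have hn := mul_le_mul_of_nonneg_right (mul_pow_succ_le hθ hθ1 n) hP
  have hpos : 0 ≤ θ ^ (n + 1) * P := by positivity
  linarith

variable [Nonempty ι] [Nonempty κ] {p q : ι → κ → G}

theorem IsBoundedOn.le_sum_boxFormSum_of_familyBoxSum (hf : IsBoundedOn f I) (hL : I.card ≤ L)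
    (hL0 : 0 < L) (hθ : 0 < θ)
    (h : θ * Fintype.card ι * Fintype.card κ ^ 4 * L ≤ ‖familyBoxSum p q f‖) :
    θ ^ 16 * Fintype.card ι ^ 2 * Fintype.card κ ^ 8 * L ≤
      ∑ i, ∑ j, boxFormSum (p i) (q i) (p j) (q j) f := by
  set a : ℝ := (Fintype.card ι : ℝ) with ha
  set k : ℝ := (Fintype.card κ : ℝ) with hk
  have pow_sixteen : (θ * a * k ^ 4 * L) ^ 16 ≤ L ^ 15 * a ^ 14 * k ^ 56 *
      ∑ i, ∑ j, boxFormSum (p i) (q i) (p j) (q j) f := calc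
    _ ≤ ‖familyBoxSum p q f‖ ^ 16 := by gcongr
    _ ≤ _ := hf.norm_familyBoxSum_pow_sixteen_le p q
    _ ≤ _ := by
      gcongr
      exact Finset.sum_nonneg fun _ _ => Finset.sum_nonneg fun _ _ => boxFormSum_nonneg _ _ _ _ _
  refine le_of_mul_le_mul_left (a := L ^ 15 * a ^ 14 * k ^ 56) ?_ (by positivity)
  exact le_of_eq_of_le (by ring) pow_sixteen

variable [DecidableEq G]

theorem IsBoundedOn.le_sum_sum_derivSumSq_of_boxFormSum (hf : IsBoundedOn f I) (hL : I.card ≤ L)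
    (hL0 : 0 < L) (hθ : 0 < θ) (hθ1 : θ ≤ 1 / 1000)
    (hp : HasFewReps p fun η => Fintype.card κ ^ 4 / (L * θ ^ 3 * η ^ 2))
    (h : θ ^ 16 * Fintype.card ι ^ 2 * Fintype.card κ ^ 8 * L ≤
      ∑ a, ∑ a', boxFormSum (p a) (q a) (p a') (q a') f) :
    θ ^ 54 * Fintype.card ι ^ 2 * Fintype.card κ ^ 4 * L ^ 2 ≤
      ∑ i : ι × κ × κ, ∑ j : ι × κ × κ,
        derivSumSq f (shiftDiff (q i.1) i.2) (shiftDiff (q j.1) j.2) := by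
  set a : ℝ := (Fintype.card ι : ℝ) with ha
  set k : ℝ := (Fintype.card κ : ℝ) with hk
  set Y := ∑ i : ι × κ × κ, ∑ j : ι × κ × κ,
    derivSumSq f (shiftDiff (q i.1) i.2) (shiftDiff (q j.1) j.2) with hY
  have sum_boxForm : ∑ t : ι × ι, ∑ h, boxForm (q t.1) (q t.2) (mulDeriv h f) = Y := by
    simp only [sum_boxForm_mulDeriv, hY, Fintype.sum_prod_type (α₁ := ι)]
    exact Finset.sum_congr rfl fun _ _ => Finset.sum_comm
  have few := hp.sum_le (η := θ ^ 17) (by positivity) (pow_le_one₀ hθ.le (by linarith))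
    (by positivity) (w := fun t h => boxForm (q t.1) (q t.2) (mulDeriv h f)) (B := k ^ 4 * L)
    (by positivity) (fun _ _ => boxForm_nonneg _ _ _)
    fun _ _ => ((hf.mulDeriv _).boxForm_le _ _).trans (by gcongr)
  rw [sum_boxForm, ← ha, ← hk] at few
  have main : θ ^ (16 + 1) * (a ^ 2 * k ^ 8 * L) ≤ k ^ 4 / (L * θ ^ 3 * (θ ^ 17) ^ 2) * Y := by
    refine pow_succ_mul_le_of_le_add hθ hθ1 (by positivity) 16 ?_
    have hpos : 0 ≤ θ ^ 17 * (a ^ 2 * k ^ 8 * L) := by positivity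
    simp only [boxFormSum, Fintype.sum_prod_type] at h few
    linarith
  rw [div_mul_eq_mul_div, le_div_iff₀ (by positivity)] at main
  refine le_of_mul_le_mul_left (a := k ^ 4) ?_ (by positivity)
  calc _ = θ ^ (16 + 1) * (a ^ 2 * k ^ 8 * L) * (L * θ ^ 3 * (θ ^ 17) ^ 2) := by ring
    _ ≤ _ := main

theorem IsBoundedOn.le_sum_sum_derivSumSq (hf : IsBoundedOn f I) (hL : I.card ≤ L)
    (hL0 : 0 < L) (hD : ∀ h ∉ D, mulDeriv h f = 0) (hDL : D.card ≤ 2 * L) (hθ : 0 < θ)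
    (hθ1 : θ ≤ 1 / 1000) (hq : HasFewReps q fun η => Fintype.card κ ^ 4 / (L * θ ^ 3 * η ^ 2))
    {ε : Type*} (E : Finset ε) (d : ε → G) {m : ℝ} (hm : 0 < m) (hE : E.card ≤ m) (n : ℕ)
    (h : θ ^ n * Fintype.card ι * Fintype.card κ ^ 2 * m * L ^ 2 ≤
      ∑ e ∈ E, ∑ i : ι × κ × κ, derivSumSq f (shiftDiff (q i.1) i.2) (d e)) :
    θ ^ (6 * n + 9) * m * L ^ 3 ≤ ∑ e ∈ E, ∑ d', derivSumSq f d' (d e) := by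
  set a : ℝ := (Fintype.card ι : ℝ)
  set k : ℝ := (Fintype.card κ : ℝ)
  set W := ∑ e ∈ E, ∑ d', derivSumSq f d' (d e)
  set η := θ ^ (2 * n + 2) with hη
  set R := k ^ 4 / (L * θ ^ 3 * η ^ 2) with hR
  have sum_sq : (θ ^ n * a * k ^ 2 * m * L ^ 2) ^ 2 ≤
      m * (2 * L ^ 2 * (m * (η * a ^ 2 * k ^ 4 * L ^ 2) + R * a ^ 2 * W)) :=
    (pow_le_pow_left₀ (by positivity) h 2).trans <|
      hf.sq_sum_sum_derivSumSq_family_le hL hD hDL hq (by positivity)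
        (pow_le_one₀ hθ.le (by linarith)) (by positivity) E d hE
  have main : θ ^ (2 * n + 1) * (a ^ 2 * k ^ 4 * m ^ 2 * L ^ 4) ≤
      2 * m * L ^ 2 * a ^ 2 * R * W := by
    refine pow_succ_mul_le_of_le_add hθ hθ1 (by positivity) (2 * n) ?_
    have hη_le : 1000 * η ≤ θ ^ (2 * n + 1) := mul_pow_succ_le hθ hθ1 _
    have hη0 : 0 < η := by positivity
    have hη_mul : 2 * η * (a ^ 2 * k ^ 4 * m ^ 2 * L ^ 4) ≤
        8 * θ ^ (2 * n + 1) * (a ^ 2 * k ^ 4 * m ^ 2 * L ^ 4) := by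
      gcongr ?_ * _
      linarith
    linear_combination sum_sq + hη_mul
  rw [hR, mul_div_assoc', div_mul_eq_mul_div, le_div_iff₀ (by positivity)] at main
  refine le_of_mul_le_mul_left (a := 2 * m * L ^ 2 * a ^ 2 * k ^ 4) ?_ (by positivity)
  calc _ = 2 * θ ^ (6 * n + 8 + 1) * (a ^ 2 * k ^ 4 * m ^ 2 * L ^ 5) := by ring
    _ ≤ θ ^ (6 * n + 8) * (a ^ 2 * k ^ 4 * m ^ 2 * L ^ 5) := by
        have hpow := mul_pow_succ_le hθ hθ1 (6 * n + 8)
        have hpos : 0 < θ ^ (6 * n + 8 + 1) := by positivity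
        gcongr ?_ * _
        linarith
    _ = θ ^ (2 * n + 1) * (a ^ 2 * k ^ 4 * m ^ 2 * L ^ 4) * (L * θ ^ 3 * η ^ 2) := by
        rw [hη]
        ring
    _ ≤ _ := main

theorem IsBoundedOn.le_sum_sum_derivSumSq_of_familyBoxSum (hf : IsBoundedOn f I)
    (hL : I.card ≤ L) (hL0 : 0 < L) (hD : ∀ h ∉ D, mulDeriv h f = 0) (hDL : D.card ≤ 2 * L)
    (hθ : 0 < θ) (hθ1 : θ ≤ 1 / 1000)
    (hp : HasFewReps p fun η => Fintype.card κ ^ 4 / (L * θ ^ 3 * η ^ 2))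
    (hq : HasFewReps q fun η => Fintype.card κ ^ 4 / (L * θ ^ 3 * η ^ 2))
    (h : θ * Fintype.card ι * Fintype.card κ ^ 4 * L ≤ ‖familyBoxSum p q f‖) :
    θ ^ 2013 * L ^ 4 ≤ ∑ d, ∑ d', derivSumSq f d d' := by
  set a : ℝ := (Fintype.card ι : ℝ) with ha
  set k : ℝ := (Fintype.card κ : ℝ) with hk
  have large_pairs : θ ^ 54 * a * k ^ 2 * (a * k ^ 2) * L ^ 2 ≤ ∑ j : ι × κ × κ, ∑ i : ι × κ × κ,
      derivSumSq f (shiftDiff (q i.1) i.2) (shiftDiff (q j.1) j.2) := by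
    rw [Finset.sum_comm]
    convert hf.le_sum_sum_derivSumSq_of_boxFormSum hL hL0 hθ hθ1 hp
      (hf.le_sum_boxFormSum_of_familyBoxSum hL hL0 hθ h) using 1
    ring
  have large_family : θ ^ 333 * (a * k ^ 2) * L ^ 3 ≤
      ∑ j : ι × κ × κ, ∑ d, derivSumSq f d (shiftDiff (q j.1) j.2) := by
    refine hf.le_sum_sum_derivSumSq hL hL0 hD hDL hθ hθ1 hq Finset.univ
      (fun j : ι × κ × κ => shiftDiff (q j.1) j.2) (by positivity) (le_of_eq ?_) 54 large_pairs
    simp only [Finset.card_univ, Fintype.card_prod, ha, hk]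
    push_cast
    ring
  have large_restricted : θ ^ 334 * a * k ^ 2 * (2 * L) * L ^ 2 ≤
      ∑ d ∈ D, ∑ i : ι × κ × κ, derivSumSq f (shiftDiff (q i.1) i.2) d := by
    rw [Finset.sum_comm]
    simp only [sum_derivSumSq_eq_sum_of_mulDeriv_eq_zero hD]
    simp only [derivSumSq_comm f _ (shiftDiff _ _)] at large_family
    refine le_trans ?_ large_family
    have hpow : 1000 * θ ^ 334 ≤ θ ^ 333 := mul_pow_succ_le hθ hθ1 333
    have hpos : 0 < θ ^ 334 := by positivity
    calc _ = 2 * θ ^ 334 * (a * k ^ 2 * L ^ 3) := by ring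
      _ ≤ θ ^ 333 * (a * k ^ 2 * L ^ 3) := by
          gcongr ?_ * _
          linarith
      _ = _ := by ring
  have final := hf.le_sum_sum_derivSumSq hL hL0 hD hDL hθ hθ1 hq D id (by positivity) hDL 334
    large_restricted
  calc θ ^ 2013 * L ^ 4 ≤ θ ^ 2013 * (2 * L) * L ^ 3 := by
        have hpos : 0 ≤ θ ^ 2013 * L ^ 4 := by positivity
        linarith
    _ ≤ ∑ d ∈ D, ∑ d', derivSumSq f d' d := final
    _ ≤ ∑ d, ∑ d', derivSumSq f d d' := by
        rw [Finset.sum_comm]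
        simp only [sum_derivSumSq_eq_sum_of_mulDeriv_eq_zero hD, le_refl]

end Concatenation

section Counting

theorem natCast_card_Icc_one {n : ℤ} (hn : 0 ≤ n) : ((Finset.Icc 1 n).card : ℝ) = n := by
  rw [Int.card_Icc, add_sub_cancel_right, ← Int.cast_natCast, Int.toNat_of_nonneg hn]

theorem card_filter_dvd_add_le {A : ℤ} (hA : 0 ≤ A) (b : ℤ) {d : ℤ} (hd : 0 < d) :
    (((Finset.Icc 1 A).filter fun a => d ∣ a + b).card : ℝ) ≤ A / d + 1 := by
  have filter_eq : ((Finset.Icc 1 A).filter fun a => d ∣ a + b) =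
      (Finset.Ioc 0 A).filter fun a => a ≡ -b [ZMOD d] := by
    ext a
    simp only [Finset.mem_filter, Finset.mem_Icc, Finset.mem_Ioc, Int.modEq_comm (b := -b),
      Int.modEq_iff_dvd, sub_neg_eq_add]
    rfl
  have card_le : ((((Finset.Ioc 0 A).filter fun a => a ≡ -b [ZMOD d]).card : ℤ) : ℚ) ≤
      A / d + 1 := by
    rw [Int.Ioc_filter_modEq_card 0 A hd]
    push_cast
    refine max_le ?_ (by positivity)
    have upper := Int.floor_le (((A : ℚ) - -b) / d)
    have lower := Int.lt_floor_add_one (((0 : ℚ) - -b) / d)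
    have split : ((A : ℚ) - -b) / d = A / d + (0 - -b) / d := by ring
    linarith
  rw [filter_eq]
  exact_mod_cast card_le

theorem card_filter_lt_gcd_le {A b : ℤ} (hA : 0 ≤ A) (hb : 0 ≤ b) (hbA : b ≤ A) {g : ℕ}
    (hg : 0 < g) :
    (((Finset.Icc 1 A ×ˢ Finset.Icc 1 A).filter
      fun t : ℤ × ℤ => g < Int.gcd (t.1 + b) (t.2 + b)).card : ℝ) ≤ 9 * A ^ 2 / g := by
  let multiples (d : ℕ) : Finset ℤ := (Finset.Icc 1 A).filter fun a => (d : ℤ) ∣ a + b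
  have cover : ((Finset.Icc 1 A ×ˢ Finset.Icc 1 A).filter
      fun t : ℤ × ℤ => g < Int.gcd (t.1 + b) (t.2 + b)) ⊆
      (Finset.Ioc g (2 * A).toNat).biUnion fun d => multiples d ×ˢ multiples d := by
    rintro ⟨x, y⟩ h
    simp only [Finset.mem_filter, Finset.mem_product, Finset.mem_Icc] at h
    simp only [multiples, Finset.mem_biUnion, Finset.mem_product, Finset.mem_filter,
      Finset.mem_Icc, Finset.mem_Ioc]
    obtain ⟨⟨hx, hy⟩, hlt⟩ := h
    have gcd_le := Int.le_of_dvd (by omega) (Int.gcd_dvd_left (x + b) (y + b))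
    exact ⟨Int.gcd (x + b) (y + b), ⟨hlt, by omega⟩, ⟨hx, Int.gcd_dvd_left ..⟩,
      ⟨hy, Int.gcd_dvd_right ..⟩⟩
  have card_multiples (d : ℕ) (hd : d ∈ Finset.Ioc g (2 * A).toNat) :
      ((multiples d).card : ℝ) ≤ 3 * A / d := by
    rw [Finset.mem_Ioc] at hd
    have hd0 : (0 : ℝ) < d := by exact_mod_cast hg.trans hd.1
    have one_le : (1 : ℝ) ≤ 2 * A / d := by
      rw [le_div_iff₀ hd0, one_mul]
      exact_mod_cast (by omega : (d : ℤ) ≤ 2 * A)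
    calc ((multiples d).card : ℝ) ≤ A / d + 1 :=
          card_filter_dvd_add_le hA b (by omega : (0 : ℤ) < d)
      _ ≤ A / d + 2 * A / d := by gcongr
      _ = 3 * A / d := by ring
  have sum_inv_sq : ∑ d ∈ Finset.Ioc g (2 * A).toNat, ((d : ℝ) ^ 2)⁻¹ ≤ (g : ℝ)⁻¹ := by
    rcases le_total g (2 * A).toNat with h | h
    · exact (sum_Ioc_inv_sq_le_sub hg.ne' h).trans (sub_le_self _ (by positivity))
    · rw [Finset.Ioc_eq_empty_of_le h, Finset.sum_empty]
      positivity
  calc _ ≤ ∑ d ∈ Finset.Ioc g (2 * A).toNat, ((multiples d ×ˢ multiples d).card : ℝ) := by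
        exact_mod_cast (Finset.card_le_card cover).trans Finset.card_biUnion_le
    _ ≤ ∑ d ∈ Finset.Ioc g (2 * A).toNat, (3 * A / d : ℝ) ^ 2 := by
        refine Finset.sum_le_sum fun d hd => ?_
        rw [Finset.card_product, Nat.cast_mul, ← sq]
        gcongr
        exact card_multiples d hd
    _ = 9 * (A : ℝ) ^ 2 * ∑ d ∈ Finset.Ioc g (2 * A).toNat, ((d : ℝ) ^ 2)⁻¹ := by
        rw [Finset.mul_sum]
        exact Finset.sum_congr rfl fun d _ => by ring
    _ ≤ 9 * (A : ℝ) ^ 2 * (g : ℝ)⁻¹ := by gcongr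
    _ = _ := by rw [div_eq_mul_inv]

theorem card_filter_lt_or_lt_gcd_le {A b : ℤ} (hA : 0 ≤ A) (hb : 0 ≤ b) (hbA : b ≤ A) {η : ℝ}
    (hη : 0 < η) (hη1 : η ≤ 1) :
    (((Finset.Icc 1 A ×ˢ Finset.Icc 1 A).filter fun t : ℤ × ℤ =>
      (t.2 : ℝ) < η * A / 2 ∨ 20 / η < Int.gcd (t.1 + b) (t.2 + b)).card : ℝ) ≤ η * A ^ 2 := by
  set g := ⌊20 / η⌋₊
  have inv_ge : 1 ≤ 1 / η := one_le_one_div hη hη1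
  have le_g : 18 / η ≤ g := by
    have := Nat.lt_floor_add_one (20 / η)
    have : 20 / η = 18 / η + 2 * (1 / η) := by ring
    linarith
  have hg : (0 : ℝ) < g := lt_of_lt_of_le (by positivity) le_g
  have card_small : ((Finset.Icc 1 ⌊η * A / 2⌋).card : ℝ) ≤ η * A / 2 := by
    have hfloor : 0 ≤ ⌊η * A / 2⌋ := Int.floor_nonneg.2 (by positivity)
    exact (natCast_card_Icc_one hfloor).trans_le (Int.floor_le _)
  have cover : ((Finset.Icc 1 A ×ˢ Finset.Icc 1 A).filter fun t : ℤ × ℤ =>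
      (t.2 : ℝ) < η * A / 2 ∨ 20 / η < Int.gcd (t.1 + b) (t.2 + b)) ⊆
      Finset.Icc 1 A ×ˢ Finset.Icc 1 ⌊η * A / 2⌋ ∪ (Finset.Icc 1 A ×ˢ Finset.Icc 1 A).filter
        fun t : ℤ × ℤ => g < Int.gcd (t.1 + b) (t.2 + b) := by
    rintro ⟨x, y⟩ h
    simp only [Finset.mem_filter, Finset.mem_product, Finset.mem_union, Finset.mem_Icc] at h ⊢
    obtain ⟨⟨hx, hy⟩, hlt | hlt⟩ := h
    · exact Or.inl ⟨hx, hy.1, Int.le_floor.2 hlt.le⟩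
    · exact Or.inr ⟨⟨hx, hy⟩, (Nat.floor_lt (by positivity)).2 hlt⟩
  calc _ ≤ (((Finset.Icc 1 A ×ˢ Finset.Icc 1 ⌊η * A / 2⌋).card : ℕ) : ℝ) +
        (((Finset.Icc 1 A ×ˢ Finset.Icc 1 A).filter
          fun t : ℤ × ℤ => g < Int.gcd (t.1 + b) (t.2 + b)).card : ℕ) := by
        exact_mod_cast (Finset.card_le_card cover).trans (Finset.card_union_le _ _)
    _ ≤ A * (η * A / 2) + 9 * A ^ 2 / (18 / η) := by
        rw [Finset.card_product, Nat.cast_mul, natCast_card_Icc_one hA]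
        gcongr ?_ * ?_ + ?_
        refine (card_filter_lt_gcd_le hA hb hbA (by exact_mod_cast hg)).trans ?_
        gcongr
    _ = η * A ^ 2 := by
        field_simp
        ring

theorem card_filter_linear_eq_le {H α α' : ℤ} (hH : 0 ≤ H) (hα' : 0 < α') (m : ℤ) :
    (((Finset.Icc 1 H ×ˢ Finset.Icc 1 H).filter
      fun z : ℤ × ℤ => α * z.1 + α' * z.2 = m).card : ℝ) ≤ 1 + H * Int.gcd α α' / α' := by
  rcases Finset.eq_empty_or_nonempty ((Finset.Icc 1 H ×ˢ Finset.Icc 1 H).filter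
    fun z : ℤ × ℤ => α * z.1 + α' * z.2 = m) with hempty | ⟨z₀, hz₀⟩
  · rw [hempty, Finset.card_empty, Nat.cast_zero]
    positivity
  have hg : (0 : ℤ) < Int.gcd α α' := by exact_mod_cast Int.gcd_pos_of_ne_zero_right α hα'.ne'
  obtain ⟨s, hs⟩ := Int.gcd_dvd_right α α'
  have hs_pos : 0 < s := pos_of_mul_pos_right (hs ▸ hα') hg.le
  have dvd_sub (z : ℤ × ℤ) (hz : α * z.1 + α' * z.2 = m) : s ∣ z.1 + -z₀.1 := by
    have hz₀ := (Finset.mem_filter.1 hz₀).2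
    have dvd_mul : α' ∣ α * (z.1 + -z₀.1) := ⟨z₀.2 - z.2, by linear_combination hz - hz₀⟩
    have dvd_gcd_mul := Int.dvd_gcd_mul_iff_dvd_mul.2 dvd_mul
    rw [Int.gcd_comm] at dvd_gcd_mul
    nth_rw 1 [hs] at dvd_gcd_mul
    exact (mul_dvd_mul_iff_left hg.ne').1 dvd_gcd_mul
  calc _ ≤ (((Finset.Icc 1 H).filter fun u => s ∣ u + -z₀.1).card : ℝ) := by
        refine Nat.cast_le.2 (Finset.card_le_card_of_injOn Prod.fst (fun z hz => ?_) ?_)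
        · simp only [Finset.coe_filter, Finset.mem_product, Set.mem_ofPred_eq] at hz ⊢
          exact ⟨hz.1.1, dvd_sub z hz.2⟩
        · intro z hz w hw hzw
          simp only [Finset.coe_filter, Set.mem_ofPred_eq] at hz hw
          have hsnd := hz.2.trans hw.2.symm
          rw [hzw, add_right_inj] at hsnd
          exact Prod.ext hzw (mul_left_cancel₀ hα'.ne' hsnd)
    _ ≤ H / s + 1 := card_filter_dvd_add_le hH _ hs_pos
    _ = 1 + H * Int.gcd α α' / α' := by
        have hgs : (α' : ℝ) = Int.gcd α α' * s := by exact_mod_cast hs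
        have hg0 : (Int.gcd α α' : ℝ) ≠ 0 := by exact_mod_cast hg.ne'
        rw [add_comm, mul_comm (H : ℝ), hgs, mul_div_mul_left _ _ hg0]

theorem card_filter_linear_cast_eq_le {H α α' B : ℤ} (hH : 0 ≤ H) (hα : 0 ≤ α) (hα' : 0 < α')
    (hαB : α ≤ B) (hα'B : α' ≤ B) {Q : ℕ} (hQ : 4 * B * H < Q) (h : ZMod Q) :
    (((Finset.Icc 1 H ×ˢ Finset.Icc 1 H).filter
      fun z : ℤ × ℤ => ((2 * (α * z.1 + α' * z.2) : ℤ) : ZMod Q) = h).card : ℝ) ≤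
      1 + H * Int.gcd α α' / α' := by
  rcases Finset.eq_empty_or_nonempty ((Finset.Icc 1 H ×ˢ Finset.Icc 1 H).filter
    fun z : ℤ × ℤ => ((2 * (α * z.1 + α' * z.2) : ℤ) : ZMod Q) = h) with hempty | ⟨z₀, hz₀⟩
  · rw [hempty, Finset.card_empty, Nat.cast_zero]
    positivity
  refine le_trans ?_ (card_filter_linear_eq_le hH hα' (α * z₀.1 + α' * z₀.2))
  refine Nat.cast_le.2 (Finset.card_le_card fun z hz => ?_)
  simp only [Finset.mem_filter, Finset.mem_product, Finset.mem_Icc] at hz hz₀ ⊢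
  refine ⟨hz.1, ?_⟩
  have hdvd : (Q : ℤ) ∣ 2 * (α * z.1 + α' * z.2) - 2 * (α * z₀.1 + α' * z₀.2) := by
    rw [← ZMod.intCast_zmod_eq_zero_iff_dvd, Int.cast_sub, hz.2, hz₀.2, sub_self]
  have bound (w : ℤ × ℤ) (hw : (1 ≤ w.1 ∧ w.1 ≤ H) ∧ 1 ≤ w.2 ∧ w.2 ≤ H) :
      0 ≤ α * w.1 + α' * w.2 ∧ α * w.1 + α' * w.2 ≤ 2 * (B * H) := by
    have hfst : 0 ≤ α * w.1 := mul_nonneg hα (by omega)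
    have hsnd : 0 ≤ α' * w.2 := mul_nonneg hα'.le (by omega)
    have hfst' : α * w.1 ≤ B * H := mul_le_mul hαB hw.1.2 (by omega) (by omega)
    have hsnd' : α' * w.2 ≤ B * H := mul_le_mul hα'B hw.2.2 (by omega) (by omega)
    omega
  have hz_bound := bound z hz.1
  have hz₀_bound := bound z₀ hz₀.1
  have hzero := Int.eq_zero_of_abs_lt_dvd hdvd (by rw [abs_lt]; constructor <;> linarith)
  omega

theorem card_filter_coe_prod_le {α β : Type*} (s : Finset α) (t : Finset β)
    (P : α × β → Prop) [DecidablePred P] :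
    ((Finset.univ : Finset (s × t)).filter fun x => P (x.1, x.2)).card ≤
      ((s ×ˢ t).filter P).card := by
  refine Finset.card_le_card_of_injOn (fun x => (x.1.1, x.2.1)) (fun x hx => ?_) ?_
  · simp_all
  · rintro ⟨⟨_, _⟩, ⟨_, _⟩⟩ _ ⟨⟨_, _⟩, ⟨_, _⟩⟩ _ h
    simp_all

theorem card_filter_shiftDiff_add_eq_le {κ G : Type*} [Fintype κ] [AddCommGroup G]
    [DecidableEq G] (p p' : κ → G) {R : ℝ}
    (hR : ∀ h, ((Finset.univ.filter fun z : κ × κ => p z.1 + p' z.2 = h).card : ℝ) ≤ R) (h : G) :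
    (((Finset.univ : Finset ((κ × κ) × (κ × κ))).filter
      fun st => shiftDiff p st.1 + shiftDiff p' st.2 = h).card : ℝ) ≤ Fintype.card κ ^ 2 * R := by
  classical
  have fiber_le (w : κ × κ) : ((((Finset.univ : Finset ((κ × κ) × (κ × κ))).filter
      fun st => shiftDiff p st.1 + shiftDiff p' st.2 = h).filter
        fun st => (st.1.2, st.2.2) = w).card : ℝ) ≤ R := by
    refine le_trans (Nat.cast_le.2 ?_) (hR (h + p w.1 + p' w.2))
    refine Finset.card_le_card_of_injOn (fun st => (st.1.1, st.2.1)) ?_ ?_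
    · rintro st hst
      rw [Finset.mem_coe, Finset.mem_filter, Finset.mem_filter] at hst
      rw [Finset.mem_coe, Finset.mem_filter, ← hst.1.2, ← hst.2]
      exact ⟨Finset.mem_univ _, by simp only [shiftDiff]; abel⟩
    · intro st hst st' hst' heq
      have snd_eq := (Finset.mem_filter.1 hst).2.trans (Finset.mem_filter.1 hst').2.symm
      simp only [Prod.ext_iff] at heq snd_eq ⊢
      exact ⟨⟨heq.1, snd_eq.1⟩, heq.2, snd_eq.2⟩
  rw [Finset.card_eq_sum_card_fiberwise (f := fun st => (st.1.2, st.2.2)) (t := Finset.univ)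
    fun _ _ => Finset.mem_coe.2 (Finset.mem_univ _), Nat.cast_sum]
  refine (Finset.sum_le_card_nsmul _ _ R fun w _ => fiber_le w).trans_eq ?_
  rw [Finset.card_univ, Fintype.card_prod, nsmul_eq_mul, Nat.cast_mul, sq]

theorem sq_mul_one_add_div_mul_le {A H L θ η : ℝ} (hA : 0 < A) (hH : 0 < H) (hL : 0 < L)
    (hθ : 0 < θ) (hθ1 : θ ≤ 1 / 1000) (h1 : θ ^ 2 * L ≤ H ^ 2) (h2 : θ ^ 2 * L ≤ H * A)
    (hη : 0 < η) (hη1 : η ≤ 1) :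
    H ^ 2 * (1 + H * (20 / η) / (η * A / 2)) ≤ H ^ 4 / (L * θ ^ 3 * η ^ 2) := by
  rw [le_div_iff₀ (by positivity)]
  calc H ^ 2 * (1 + H * (20 / η) / (η * A / 2)) * (L * θ ^ 3 * η ^ 2)
      = H ^ 2 * (θ * η ^ 2 * (θ ^ 2 * L) + 40 * θ * (H / A) * (θ ^ 2 * L)) := by
        field_simp
        ring
    _ ≤ H ^ 2 * (θ * 1 * H ^ 2 + 40 * θ * (H / A) * (H * A)) := by
        gcongr
        exact pow_le_one₀ hη.le hη1
    _ = 41 * θ * H ^ 4 := by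
        field_simp
        ring
    _ ≤ H ^ 4 := mul_le_of_le_one_left (by positivity) (by linarith)

theorem hasFewReps_progressions {A H b : ℤ} (hA : 1 ≤ A) (hH : 1 ≤ H) (hb : 0 ≤ b) (hbA : b ≤ A)
    {Q : ℕ} (hQ : 16 * A * H < Q) {L θ : ℝ} (hL : 0 < L) (hθ : 0 < θ) (hθ1 : θ ≤ 1 / 1000)
    (h1 : θ ^ 2 * L ≤ H ^ 2) (h2 : θ ^ 2 * L ≤ H * A) :
    HasFewReps (fun (a : Finset.Icc (1 : ℤ) A) (i : Finset.Icc (1 : ℤ) H) =>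
      ((2 * (a + b) * i : ℤ) : ZMod Q))
      fun η => (Fintype.card (Finset.Icc (1 : ℤ) H) : ℝ) ^ 4 / (L * θ ^ 3 * η ^ 2) := by
  have hA0 : (0 : ℝ) < A := by exact_mod_cast (by omega : 0 < A)
  have hH0 : (0 : ℝ) < H := by exact_mod_cast (by omega : 0 < H)
  simp only [HasFewReps, Fintype.card_coe, natCast_card_Icc_one (by omega : 0 ≤ A),
    natCast_card_Icc_one (by omega : 0 ≤ H)]
  intro η hη hη1
  let IsBad : ℤ × ℤ → Prop := fun t =>
    (t.2 : ℝ) < η * A / 2 ∨ 20 / η < Int.gcd (t.1 + b) (t.2 + b)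
  refine ⟨Finset.univ.filter fun t => IsBad (t.1, t.2),
    (Nat.cast_le.2 (card_filter_coe_prod_le _ _ IsBad)).trans
      (card_filter_lt_or_lt_gcd_le (by omega) hb hbA hη hη1), ?_⟩
  rintro ⟨⟨x, hx⟩, ⟨y, hy⟩⟩ hgood
  simp only [Finset.mem_filter, Finset.mem_univ, true_and, IsBad, not_or, not_lt] at hgood
  rw [Finset.mem_Icc] at hx hy
  have le_y : η * A / 2 ≤ ((y + b : ℤ) : ℝ) :=
    hgood.1.trans (by exact_mod_cast le_add_of_nonneg_right hb)
  let pattern (a i : ℤ) : ZMod Q := ((2 * (a + b) * i : ℤ) : ZMod Q)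
  have reps_le (h : ZMod Q) : ((Finset.univ.filter fun z : Finset.Icc (1 : ℤ) H ×
      Finset.Icc (1 : ℤ) H => pattern x z.1 + pattern y z.2 = h).card : ℝ) ≤
      1 + H * (20 / η) / (η * A / 2) := by
    calc _ ≤ (((Finset.Icc 1 H ×ˢ Finset.Icc 1 H).filter fun z : ℤ × ℤ =>
          ((2 * ((x + b) * z.1 + (y + b) * z.2) : ℤ) : ZMod Q) = h).card : ℝ) := by
          simp only [pattern, ← Int.cast_add, mul_assoc, ← mul_add]
          exact Nat.cast_le.2 (card_filter_coe_prod_le _ _ fun z : ℤ × ℤ =>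
            ((2 * ((x + b) * z.1 + (y + b) * z.2) : ℤ) : ZMod Q) = h)
      _ ≤ 1 + H * Int.gcd (x + b) (y + b) / ((y + b : ℤ) : ℝ) :=
          card_filter_linear_cast_eq_le (B := 2 * A) (by omega) (by omega) (by omega) (by omega)
            (by omega) (by linarith) h
      _ ≤ 1 + H * (20 / η) / (η * A / 2) := by
          gcongr
          exact hgood.2
  intro h
  refine (card_filter_shiftDiff_add_eq_le (fun i : Finset.Icc (1 : ℤ) H => pattern x i)
    (fun i : Finset.Icc (1 : ℤ) H => pattern y i) reps_le h).trans ?_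
  rw [Fintype.card_coe, natCast_card_Icc_one (by omega)]
  exact sq_mul_one_add_div_mul_le hA0 hH0 hL hθ hθ1 h1 h2 hη hη1

end Counting

section GowersNorm

variable {f : ℤ → ℂ} {L : ℤ}

theorem mulDiff_zero (h : ℤ) : mulDiff h 0 = 0 := by
  funext x
  simp [mulDiff]

theorem mulDiff_eq_zero_of_notMem (hf : ∀ x ∉ Finset.Icc 1 L, f x = 0) (h x : ℤ)
    (hx : x ∉ Finset.Icc 1 L) : mulDiff h f x = 0 := by
  simp [mulDiff, hf x hx]

theorem mulDiff_eq_zero_of_shift_notMem (hf : ∀ x ∉ Finset.Icc 1 L, f x = 0) {h : ℤ}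
    (hh : h ∉ Finset.Ioo (-L) L) : mulDiff h f = 0 := by
  funext x
  by_cases hx : x ∈ Finset.Icc 1 L
  · have hxh : x + h ∉ Finset.Icc 1 L := by
      rw [Finset.mem_Ioo] at hh
      rw [Finset.mem_Icc] at hx ⊢
      omega
    simp [mulDiff, hf _ hxh]
  · simp [mulDiff, hf _ hx]

theorem mulDiffs_eq_zero_of_notMem (hf : ∀ x ∉ Finset.Icc 1 L, f x = 0) (hs : List ℤ) :
    ∀ x ∉ Finset.Icc 1 L, mulDiffs hs f x = 0 := by
  induction hs with
  | nil => exact hf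
  | cons h hs ih => exact mulDiff_eq_zero_of_notMem ih h

theorem mulDiffs_eq_zero_of_shift_notMem (hf : ∀ x ∉ Finset.Icc 1 L, f x = 0) {hs : List ℤ}
    {h : ℤ} (hmem : h ∈ hs) (hh : h ∉ Finset.Ioo (-L) L) : mulDiffs hs f = 0 := by
  induction hs with
  | nil => exact absurd hmem List.not_mem_nil
  | cons k hs ih =>
    rcases List.mem_cons.1 hmem with rfl | hmem
    · exact mulDiff_eq_zero_of_shift_notMem (mulDiffs_eq_zero_of_notMem hf hs) hh
    · rw [mulDiffs, List.foldr_cons, ← mulDiffs, ih hmem, mulDiff_zero]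

theorem sum_sum_mulDiff (hf : ∀ x ∉ Finset.Icc 1 L, f x = 0) :
    ∑ h ∈ Finset.Ioo (-L) L, ∑ x ∈ Finset.Icc 1 L, mulDiff h f x =
      ((‖∑ x ∈ Finset.Icc 1 L, f x‖ ^ 2 : ℝ) : ℂ) := by
  rw [Finset.sum_comm, ← Complex.normSq_eq_norm_sq, ← Complex.mul_conj, map_sum, Finset.mul_sum]
  refine Finset.sum_congr rfl fun x hx => ?_
  rw [Finset.mem_Icc] at hx
  rw [Finset.sum_mul]
  symm
  refine Finset.sum_of_injOn (fun y => y - x) (sub_left_injective.injOn) ?_ ?_ ?_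
  · intro y hy
    simp only [Finset.coe_Icc, Set.mem_Icc, Finset.coe_Ioo, Set.mem_Ioo] at hy ⊢
    omega
  · intro h _ hh
    have hxh : x + h ∉ Finset.Icc 1 L := fun hmem => hh ⟨x + h, hmem, add_sub_cancel_left x h⟩
    rw [mulDiff, hf _ hxh, zero_mul]
  · intro y _
    rw [mulDiff, add_sub_cancel]

theorem sum_piFinset_succ {α E : Type*} [AddCommMonoid E] (s : ℕ) (D : Finset α)
    (g : (Fin (s + 1) → α) → E) :
    ∑ h ∈ Fintype.piFinset fun _ : Fin (s + 1) => D, g h =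
      ∑ k ∈ D, ∑ h ∈ Fintype.piFinset fun _ : Fin s => D, g (Fin.cons k h) := by
  rw [← Finset.sum_product']
  refine (Finset.sum_equiv (Fin.consEquiv fun _ => α) (fun p => ?_) fun p _ => rfl).symm
  rw [Finset.mem_product]
  simp [Fintype.mem_piFinset, Fin.forall_fin_succ]

theorem gowersNorm_succ_pow (s : ℕ) (hf : ∀ x ∉ Finset.Icc 1 L, f x = 0) :
    gowersNorm (s + 1) f ^ 2 ^ (s + 1) =
      ∑ h ∈ Fintype.piFinset fun _ : Fin s => Finset.Ioo (-L) L,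
        ‖∑ x ∈ Finset.Icc 1 L, mulDiffs (List.ofFn h) f x‖ ^ 2 := by
  have tsum_eq : ∑' p : ℤ × (Fin (s + 1) → ℤ), mulDiffs (List.ofFn p.2) f p.1 =
      ((∑ h ∈ Fintype.piFinset fun _ : Fin s => Finset.Ioo (-L) L,
        ‖∑ x ∈ Finset.Icc 1 L, mulDiffs (List.ofFn h) f x‖ ^ 2 : ℝ) : ℂ) := by
    rw [tsum_eq_sum (s := Finset.Icc 1 L ×ˢ Fintype.piFinset fun _ => Finset.Ioo (-L) L),
      Finset.sum_product_right, sum_piFinset_succ, Finset.sum_comm, Complex.ofReal_sum]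
    · refine Finset.sum_congr rfl fun h _ => ?_
      rw [← sum_sum_mulDiff (mulDiffs_eq_zero_of_notMem hf _)]
      simp only [List.ofFn_cons, mulDiffs, List.foldr_cons]
    · rintro ⟨x, h⟩ hp
      simp only [Finset.mem_product, Fintype.mem_piFinset, not_and_or, not_forall] at hp
      rcases hp with hx | ⟨i, hi⟩
      · exact mulDiffs_eq_zero_of_notMem hf _ x hx
      · rw [mulDiffs_eq_zero_of_shift_notMem hf (List.mem_ofFn.2 ⟨i, rfl⟩) hi, Pi.zero_apply]
  rw [gowersNorm, tsum_eq, Complex.ofReal_re, ← Real.rpow_natCast, ← Real.rpow_mul (by positivity),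
    Nat.cast_pow, Nat.cast_ofNat, one_div, inv_mul_cancel₀ (by positivity), Real.rpow_one]

theorem gowersNorm_three_pow (hf : ∀ x ∉ Finset.Icc 1 L, f x = 0) :
    gowersNorm 3 f ^ 2 ^ 3 = ∑ d ∈ Finset.Ioo (-L) L, ∑ d' ∈ Finset.Ioo (-L) L,
      ‖∑ x ∈ Finset.Icc 1 L, mulDiff d (mulDiff d' f) x‖ ^ 2 := by
  rw [gowersNorm_succ_pow 2 hf, sum_piFinset_succ]
  refine Finset.sum_congr rfl fun d _ => ?_
  rw [sum_piFinset_succ]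
  simp [mulDiffs]

theorem gowersNorm_succ_pow_sq_le (s : ℕ) (hL : 0 ≤ L) (hf : ∀ x ∉ Finset.Icc 1 L, f x = 0) :
    (gowersNorm (s + 1) f ^ 2 ^ (s + 1)) ^ 2 ≤
      (2 * L) ^ (s + 1) * gowersNorm (s + 2) f ^ 2 ^ (s + 2) := by
  set D := Finset.Ioo (-L) L with hD
  set S := fun h : Fin (s + 1) → ℤ => ∑ x ∈ Finset.Icc 1 L, mulDiffs (List.ofFn h) f x with hS
  have eq_sum : ((gowersNorm (s + 1) f ^ 2 ^ (s + 1) : ℝ) : ℂ) =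
      ∑ h ∈ Fintype.piFinset fun _ => D, S h := by
    rw [gowersNorm_succ_pow s hf, sum_piFinset_succ, Finset.sum_comm, Complex.ofReal_sum]
    refine Finset.sum_congr rfl fun h _ => ?_
    rw [← sum_sum_mulDiff (mulDiffs_eq_zero_of_notMem hf _)]
    simp only [hS, List.ofFn_cons, mulDiffs, List.foldr_cons, hD]
  have card_le : (D.card : ℝ) ≤ 2 * L := by
    have card_le_int : (D.card : ℤ) ≤ 2 * L := by
      rw [hD, Int.card_Ioo]
      omega
    exact_mod_cast card_le_int
  rw [gowersNorm_succ_pow (s + 1) hf]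
  calc _ = ‖∑ h ∈ Fintype.piFinset fun _ => D, S h‖ ^ 2 := by
        rw [← eq_sum, Complex.norm_real, Real.norm_eq_abs, sq_abs]
    _ ≤ (∑ h ∈ Fintype.piFinset fun _ => D, ‖S h‖) ^ 2 := by
        gcongr
        exact norm_sum_le _ _
    _ ≤ (Fintype.piFinset fun _ : Fin (s + 1) => D).card *
          ∑ h ∈ Fintype.piFinset fun _ => D, ‖S h‖ ^ 2 := sq_sum_le_card_mul_sum_sq
    _ ≤ (2 * L) ^ (s + 1) * ∑ h ∈ Fintype.piFinset fun _ => D, ‖S h‖ ^ 2 := by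
        rw [Fintype.card_piFinset_const, Nat.cast_pow]
        gcongr

end GowersNorm

/-- The unnormalized sum underlying `boxAverage`, over `1 ≤ a ≤ A`, over the shifts
`d (a + b) (s₁ - s₂)` and `d a (t₁ - t₂)` with `s, t ∈ [H]²`, and over `1 ≤ x ≤ L`. -/
noncomputable def boxSum (d A H L b : ℤ) (f : ℤ → ℂ) : ℂ :=
  ∑ a ∈ Finset.Icc 1 A, ∑ s ∈ Finset.Icc 1 H ×ˢ Finset.Icc 1 H,
    ∑ t ∈ Finset.Icc 1 H ×ˢ Finset.Icc 1 H, ∑ x ∈ Finset.Icc 1 L,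
      mulDiff (d * (a + b) * (s.1 - s.2)) (mulDiff (d * a * (t.1 - t.2)) f) x

section Transfer

/-- Transport of a function on `ℤ` to `ℤ/Qℤ` through the representatives in `[0, Q)`. -/
def liftMod (Q : ℕ) (f : ℤ → ℂ) : ZMod Q → ℂ := fun z => f z.val

variable {f : ℤ → ℂ} {L : ℤ} {Q : ℕ}

theorem intCast_injOn_of_forall_lt {s : Finset ℤ} (hs : ∀ x ∈ s, ∀ y ∈ s, x - y < Q) :
    Set.InjOn (Int.cast : ℤ → ZMod Q) s := by
  intro x hx y hy hxy
  have hxy' := hs x hx y hy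
  have hyx' := hs y hy x hx
  rw [← sub_eq_zero, ← Int.cast_sub, ZMod.intCast_zmod_eq_zero_iff_dvd] at hxy
  have := Int.eq_zero_of_abs_lt_dvd hxy (abs_lt.2 ⟨by omega, by omega⟩)
  omega

variable [NeZero Q]

theorem liftMod_intCast (hf : ∀ x ∉ Finset.Icc 1 L, f x = 0) {n : ℤ} (h1 : L - Q < n) (h2 : n < Q) :
    liftMod Q f (n : ZMod Q) = f n := by
  rw [liftMod, ZMod.val_intCast]
  rcases le_or_gt 0 n with h | h
  · rw [Int.emod_eq_of_lt h h2]
  · have _ := Int.emod_nonneg n (by exact_mod_cast NeZero.ne Q : (Q : ℤ) ≠ 0)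
    have hn : n ∉ Finset.Icc 1 L := by
      rw [Finset.mem_Icc]
      omega
    have hmod : n % Q ∉ Finset.Icc 1 L := by
      rw [Finset.mem_Icc]
      rcases le_or_gt L 0 with hL | hL
      · omega
      · rw [← Int.add_emod_right, Int.emod_eq_of_lt (by omega) (by omega)]
        omega
    rw [hf _ hmod, hf _ hn]

theorem isBoundedOn_liftMod (hf1 : IsOneBounded f) (hf : ∀ x ∉ Finset.Icc 1 L, f x = 0) :
    IsBoundedOn (liftMod Q f) ((Finset.Icc 1 L).image Int.cast) where
  norm_le z := hf1 _
  eq_zero z hz := hf _ fun h => hz (Finset.mem_image.2 ⟨_, h, by simp⟩)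

theorem mulDeriv_liftMod_eq_zero (hf : ∀ x ∉ Finset.Icc 1 L, f x = 0) (h : ZMod Q)
    (hh : h ∉ (Finset.Ioo (-L) L).image (Int.cast : ℤ → ZMod Q)) :
    mulDeriv h (liftMod Q f) = 0 := by
  funext z
  simp only [mulDeriv, Pi.zero_apply, mul_eq_zero, map_eq_zero]
  by_contra! hne
  have mem_shift : ((z + h).val : ℤ) ∈ Finset.Icc 1 L := by_contra fun hn => hne.1 (hf _ hn)
  have mem : (z.val : ℤ) ∈ Finset.Icc 1 L := by_contra fun hn => hne.2 (hf _ hn)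
  rw [Finset.mem_Icc] at mem_shift mem
  refine hh (Finset.mem_image.2 ⟨(z + h).val - z.val, ?_, by simp⟩)
  rw [Finset.mem_Ioo]
  omega

theorem sum_mulDeriv_liftMod (hf1 : IsOneBounded f) (hf : ∀ x ∉ Finset.Icc 1 L, f x = 0) {d d' : ℤ}
    (hd : L + |d| + |d'| < Q) :
    ∑ z, mulDeriv (d : ZMod Q) (mulDeriv (d' : ZMod Q) (liftMod Q f)) z =
      ∑ x ∈ Finset.Icc 1 L, mulDiff d (mulDiff d' f) x := by
  have bound := abs_le.1 (le_refl |d|)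
  have bound' := abs_le.1 (le_refl |d'|)
  have inj : Set.InjOn (Int.cast : ℤ → ZMod Q) (Finset.Icc 1 L) :=
    intCast_injOn_of_forall_lt fun x hx y hy => by
      rw [Finset.mem_Icc] at hx hy
      omega
  rw [← Finset.sum_subset (Finset.subset_univ _) fun z _ hz =>
    (((isBoundedOn_liftMod hf1 hf).mulDeriv _).mulDeriv _).eq_zero z hz, Finset.sum_image inj]
  refine Finset.sum_congr rfl fun x hx => ?_
  rw [Finset.mem_Icc] at hx
  simp only [mulDeriv, mulDiff, ← Int.cast_add]
  rw [liftMod_intCast hf (by omega) (by omega), liftMod_intCast hf (by omega) (by omega),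
    liftMod_intCast hf (by omega) (by omega), liftMod_intCast hf (by omega) (by omega)]

theorem sum_sum_derivSumSq_liftMod (hf1 : IsOneBounded f) (hf : ∀ x ∉ Finset.Icc 1 L, f x = 0)
    (hLQ : 4 * L ≤ Q) :
    ∑ d, ∑ d', derivSumSq (liftMod Q f) d d' = gowersNorm 3 f ^ 2 ^ 3 := by
  have inj : Set.InjOn (Int.cast : ℤ → ZMod Q) (Finset.Ioo (-L) L) :=
    intCast_injOn_of_forall_lt fun x hx y hy => by
      rw [Finset.mem_Ioo] at hx hy
      omega
  have hD := mulDeriv_liftMod_eq_zero (Q := Q) hf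
  simp only [← sum_derivSumSq_eq_sum_of_mulDeriv_eq_zero hD]
  rw [Finset.sum_comm]
  simp only [derivSumSq_comm (liftMod Q f) _,
    ← sum_derivSumSq_eq_sum_of_mulDeriv_eq_zero hD]
  rw [gowersNorm_three_pow hf, Finset.sum_image inj]
  refine Finset.sum_congr rfl fun d hd => ?_
  rw [Finset.sum_image inj]
  refine Finset.sum_congr rfl fun d' hd' => ?_
  rw [Finset.mem_Ioo, ← abs_lt] at hd hd'
  rw [derivSumSq, sum_mulDeriv_liftMod hf1 hf (by omega)]

theorem abs_two_mul_mul_sub_le {A H c i j : ℤ} (hc : 0 ≤ c) (hcA : c ≤ 2 * A)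
    (hi : i ∈ Finset.Icc 1 H) (hj : j ∈ Finset.Icc 1 H) : |2 * c * (i - j)| ≤ 4 * A * H := by
  rw [Finset.mem_Icc] at hi hj
  calc |2 * c * (i - j)| = 2 * c * |i - j| := by rw [abs_mul, abs_of_nonneg (by omega)]
    _ ≤ (4 * A) * H :=
        mul_le_mul (by omega) (abs_le.2 ⟨by omega, by omega⟩) (abs_nonneg _) (by omega)

theorem familyBoxSum_liftMod (hf1 : IsOneBounded f) (hf : ∀ x ∉ Finset.Icc 1 L, f x = 0)
    {A H b : ℤ} (hb : 0 ≤ b) (hbA : b ≤ A) (hQ : L + 8 * A * H < Q) :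
    familyBoxSum (fun (a : Finset.Icc (1 : ℤ) A) (i : Finset.Icc (1 : ℤ) H) =>
        ((2 * (a + b) * i : ℤ) : ZMod Q))
      (fun (a : Finset.Icc (1 : ℤ) A) (i : Finset.Icc (1 : ℤ) H) =>
        ((2 * (a + 0) * i : ℤ) : ZMod Q)) (liftMod Q f) = boxSum 2 A H L b f := by
  simp only [familyBoxSum, boxSum, shiftDiff, ← Int.cast_sub, ← mul_sub, Fintype.sum_prod_type,
    Finset.sum_product]
  simp only [← Finset.sum_coe_sort (Finset.Icc 1 A), ← Finset.sum_coe_sort (Finset.Icc 1 H)]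
  refine Finset.sum_congr rfl fun a _ => Finset.sum_congr rfl fun i _ =>
    Finset.sum_congr rfl fun i' _ => Finset.sum_congr rfl fun j _ =>
    Finset.sum_congr rfl fun j' _ => ?_
  have ha := Finset.mem_Icc.1 a.2
  have bound : |2 * (a + b) * ((i : ℤ) - i')| ≤ 4 * A * H :=
    abs_two_mul_mul_sub_le (by omega) (by omega) i.2 i'.2
  have bound' : |2 * (a : ℤ) * ((j : ℤ) - j')| ≤ 4 * A * H :=
    abs_two_mul_mul_sub_le (by omega) (by omega) j.2 j'.2
  rw [add_zero, sum_mulDeriv_liftMod hf1 hf (by linarith)]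

theorem pow_mul_le_gowersNorm_three_pow (hf1 : IsOneBounded f)
    (hf : ∀ x ∉ Finset.Icc 1 L, f x = 0) {A H b : ℤ} (hA : 1 ≤ A) (hH : 1 ≤ H) (hL : 1 ≤ L)
    (hb : 0 ≤ b) (hbA : b ≤ A) {θ : ℝ} (hθ : 0 < θ) (hθ1 : θ ≤ 1 / 1000)
    (h1 : θ ^ 2 * L ≤ H ^ 2) (h2 : θ ^ 2 * L ≤ H * A)
    (h : θ * A * H ^ 4 * L ≤ ‖boxSum 2 A H L b f‖) :
    θ ^ 2013 * L ^ 4 ≤ gowersNorm 3 f ^ 2 ^ 3 := by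
  have hAH : 0 < A * H := by positivity
  -- The shifts in the box sum are at most `4 A H`, so none of them wraps around modulo this `Q`.
  obtain ⟨Q, hQ⟩ := Int.eq_ofNat_of_zero_le (by linarith : 0 ≤ 16 * A * H + 4 * L)
  have : NeZero Q := ⟨by rintro rfl; push_cast at hQ; linarith⟩
  have : Nonempty (Finset.Icc (1 : ℤ) A) := ⟨⟨1, by simpa using hA⟩⟩
  have : Nonempty (Finset.Icc (1 : ℤ) H) := ⟨⟨1, by simpa using hH⟩⟩
  have hLr : (0 : ℝ) < L := by exact_mod_cast hL
  have hI : (((Finset.Icc 1 L).image (Int.cast : ℤ → ZMod Q)).card : ℝ) ≤ L := by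
    rw [← natCast_card_Icc_one (by omega : 0 ≤ L)]
    exact_mod_cast Finset.card_image_le
  have hD : (((Finset.Ioo (-L) L).image (Int.cast : ℤ → ZMod Q)).card : ℝ) ≤ 2 * L := by
    have card_le : ((Finset.Ioo (-L) L).card : ℤ) ≤ 2 * L := by
      rw [Int.card_Ioo]
      omega
    exact_mod_cast (Int.ofNat_le.2 Finset.card_image_le).trans card_le
  rw [← sum_sum_derivSumSq_liftMod (Q := Q) hf1 hf (by linarith)]
  refine (isBoundedOn_liftMod hf1 hf).le_sum_sum_derivSumSq_of_familyBoxSum hI hLr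
    (mulDeriv_liftMod_eq_zero hf) hD hθ hθ1
    (hasFewReps_progressions hA hH hb hbA (by linarith) hLr hθ hθ1 h1 h2)
    (hasFewReps_progressions hA hH le_rfl (by linarith) (by linarith) hLr hθ hθ1 h1 h2) ?_
  rw [familyBoxSum_liftMod hf1 hf hb hbA (by linarith), Fintype.card_coe, Fintype.card_coe,
    natCast_card_Icc_one (by omega), natCast_card_Icc_one (by omega)]
  exact h

end Transfer

section BoxAverage

theorem fejerWeight_eq_zero {δ M : ℝ} {h : ℤ} (hh : h ∉ Finset.Icc (-⌊δ * M⌋) ⌊δ * M⌋) :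
    fejerWeight δ M h = 0 := by
  rw [fejerWeight, Finset.filter_eq_empty_iff.2, Finset.card_empty, Nat.cast_zero, zero_div]
  rintro ⟨x, y⟩ hxy heq
  simp only [initInterval, Finset.mem_product, Finset.mem_Icc] at hxy hh heq
  omega

theorem sum_fejerWeight_mul (δ M : ℝ) (g : ℤ → ℂ) :
    ∑ h ∈ Finset.Icc (-⌊δ * M⌋) ⌊δ * M⌋, (fejerWeight δ M h : ℂ) * g h =
      (∑ s ∈ initInterval (δ * M) ×ˢ initInterval (δ * M), g (s.1 - s.2)) /
        ((δ ^ 2 * M : ℝ) : ℂ) := by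
  rw [← Finset.sum_fiberwise_of_maps_to (t := Finset.Icc (-⌊δ * M⌋) ⌊δ * M⌋)
    (g := fun s : ℤ × ℤ => s.1 - s.2), Finset.sum_div]
  · refine Finset.sum_congr rfl fun h _ => ?_
    rw [Finset.sum_congr rfl (g := fun _ => g h)
      fun s hs => by rw [(Finset.mem_filter.1 hs).2], Finset.sum_const, nsmul_eq_mul, fejerWeight]
    push_cast
    ring
  · rintro ⟨x, y⟩ hxy
    simp only [initInterval, Finset.mem_product, Finset.mem_Icc] at hxy ⊢
    omega

variable {f : ℤ → ℂ} {L : ℤ}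

theorem tsum_fejerWeight_mulDiffs (hf : ∀ x ∉ Finset.Icc 1 L, f x = 0) (δ M : ℝ) (P R : ℤ) :
    ∑' p : ℤ × ℤ × ℤ, (fejerWeight δ M p.2.1 : ℂ) * (fejerWeight δ M p.2.2 : ℂ) *
        mulDiffs [P * p.2.1, R * p.2.2] f p.1 =
      (∑ s ∈ initInterval (δ * M) ×ˢ initInterval (δ * M),
        ∑ t ∈ initInterval (δ * M) ×ˢ initInterval (δ * M), ∑ x ∈ Finset.Icc 1 L,
          mulDiff (P * (s.1 - s.2)) (mulDiff (R * (t.1 - t.2)) f) x) /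
        (((δ ^ 2 * M) ^ 2 : ℝ) : ℂ) := by
  set D := Finset.Icc (-⌊δ * M⌋) ⌊δ * M⌋ with hD
  set S := fun h₁ h₂ : ℤ => ∑ x ∈ Finset.Icc 1 L, mulDiff (P * h₁) (mulDiff (R * h₂) f) x with hS
  calc _ = ∑ h₁ ∈ D, (fejerWeight δ M h₁ : ℂ) *
        ∑ h₂ ∈ D, (fejerWeight δ M h₂ : ℂ) * S h₁ h₂ := by
        rw [tsum_eq_sum (s := Finset.Icc 1 L ×ˢ D ×ˢ D), Finset.sum_product_right]
        · simp only [Finset.sum_product, Finset.mul_sum, hS, mul_assoc]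
          rfl
        · rintro ⟨x, h₁, h₂⟩ hp
          simp only [Finset.mem_product, not_and_or] at hp
          rcases hp with hx | h | h
          · rw [mulDiffs_eq_zero_of_notMem hf _ _ hx, mul_zero]
          · simp [fejerWeight_eq_zero h]
          · simp [fejerWeight_eq_zero h]
    _ = _ := by
        simp only [hD, sum_fejerWeight_mul]
        rw [← Finset.sum_div, div_div]
        push_cast
        ring

theorem boxAverage_eq (hf : ∀ x ∉ Finset.Icc 1 L, f x = 0) (q : ℕ) {δ δ' M : ℝ}
    (hA : 1 ≤ ⌊δ * M⌋) (b : ℤ) :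
    boxAverage q δ δ' M b f =
      (boxSum (2 * q) ⌊δ * M⌋ ⌊δ' * M⌋ L b f).re / (⌊δ * M⌋ * (δ' ^ 2 * M) ^ 2) := by
  have card_eq : ((initInterval (δ * M)).card : ℂ) = ((⌊δ * M⌋ : ℝ) : ℂ) := by
    exact_mod_cast congrArg ((↑) : ℝ → ℂ)
      (natCast_card_Icc_one (by omega : 0 ≤ ⌊δ * M⌋))
  simp only [boxAverage, tsum_fejerWeight_mulDiffs hf]
  rw [Finset.expect_eq_sum_div_card, ← Finset.sum_div, div_div, card_eq, ← Complex.ofReal_mul,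
    Complex.div_ofReal_re, mul_comm ((δ' ^ 2 * M) ^ 2)]
  rfl

theorem norm_sum_mulDiff_mulDiff_le (hL : 0 ≤ L) (hf1 : IsOneBounded f) (d d' : ℤ) :
    ‖∑ x ∈ Finset.Icc 1 L, mulDiff d (mulDiff d' f) x‖ ≤ L := by
  have norm_le_one : ∀ x ∈ Finset.Icc 1 L, ‖mulDiff d (mulDiff d' f) x‖ ≤ 1 := by
    intro x _
    simp only [mulDiff, norm_mul, map_mul, RCLike.norm_conj]
    exact mul_le_one₀ (mul_le_one₀ (hf1 _) (norm_nonneg _) (hf1 _)) (by positivity)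
      (mul_le_one₀ (hf1 _) (norm_nonneg _) (hf1 _))
  refine (norm_sum_le_of_le _ norm_le_one).trans_eq ?_
  rw [Finset.sum_const, nsmul_eq_mul, mul_one, natCast_card_Icc_one hL]

/-- The pairs in `[H]²` whose difference, dilated by `c`, lies in `(-L, L)`; no others
contribute to a box sum of a function supported in `[1, L]`. -/
noncomputable def closePairs (H L c : ℤ) : Finset (ℤ × ℤ) :=
  {s ∈ Finset.Icc 1 H ×ˢ Finset.Icc 1 H | c * (s.1 - s.2) ∈ Finset.Ioo (-L) L}

theorem card_closePairs_le_sq {H : ℤ} (hH : 0 ≤ H) (L c : ℤ) :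
    ((closePairs H L c).card : ℝ) ≤ H ^ 2 := by
  rw [sq, ← natCast_card_Icc_one hH]
  exact_mod_cast (Finset.card_filter_le _ _).trans_eq (Finset.card_product _ _)

theorem card_closePairs_le {H c : ℤ} (hH : 0 ≤ H) (hL : 0 ≤ L) (hc : 0 < c) :
    ((closePairs H L c).card : ℝ) ≤ H * (2 * L / c + 1) := by
  have subset : closePairs H L c ⊆ (Finset.Icc 1 H).biUnion fun i =>
      {i} ×ˢ Finset.Icc (i - L / c) (i + L / c) := by
    rintro ⟨i, j⟩ hij
    simp only [closePairs, Finset.mem_filter, Finset.mem_product, Finset.mem_Ioo] at hij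
    have upper : i - j ≤ L / c := (Int.le_ediv_iff_mul_le hc).2 (by linarith)
    have lower : -(i - j) ≤ L / c := (Int.le_ediv_iff_mul_le hc).2 (by linarith)
    simp only [Finset.mem_biUnion, Finset.mem_product, Finset.mem_singleton]
    exact ⟨i, hij.1.1, rfl, Finset.mem_Icc.2 ⟨by omega, by omega⟩⟩
  have card_fiber : ∀ i ∈ Finset.Icc 1 H,
      (({i} ×ˢ Finset.Icc (i - L / c) (i + L / c)).card : ℝ) = 2 * (L / c : ℤ) + 1 := by
    intro i _
    have hLc : 0 ≤ L / c := Int.ediv_nonneg hL hc.le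
    have card_int : ((Finset.Icc (i - L / c) (i + L / c)).card : ℤ) = 2 * (L / c) + 1 := by
      rw [Int.card_Icc]
      omega
    rw [Finset.card_product, Finset.card_singleton, one_mul]
    exact_mod_cast card_int
  have hc' : (0 : ℝ) < c := by exact_mod_cast hc
  have floor_le : ((L / c : ℤ) : ℝ) ≤ L / c := by
    rw [le_div_iff₀ hc']
    exact_mod_cast Int.ediv_mul_le L hc.ne'
  calc ((closePairs H L c).card : ℝ)
      ≤ ∑ i ∈ Finset.Icc 1 H, (({i} ×ˢ Finset.Icc (i - L / c) (i + L / c)).card : ℝ) := by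
        exact_mod_cast (Finset.card_le_card subset).trans Finset.card_biUnion_le
    _ = H * (2 * (L / c : ℤ) + 1) := by
        rw [Finset.sum_congr rfl card_fiber, Finset.sum_const, nsmul_eq_mul,
          natCast_card_Icc_one hH]
    _ ≤ H * (2 * L / c + 1) := by
        rw [mul_div_assoc]
        gcongr

theorem norm_boxSum_le_sum_card {A H b d : ℤ} (hL : 0 ≤ L) (hf1 : IsOneBounded f)
    (hf : ∀ x ∉ Finset.Icc 1 L, f x = 0) :
    ‖boxSum d A H L b f‖ ≤ ∑ a ∈ Finset.Icc 1 A,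
      ((closePairs H L (d * (a + b))).card : ℝ) * (closePairs H L (d * a)).card * L := by
  refine norm_sum_le_of_le _ fun a _ => ?_
  rw [← Finset.sum_subset (Finset.filter_subset _ _ : closePairs H L (d * (a + b)) ⊆ _)]
  · rw [mul_assoc, ← nsmul_eq_mul]
    refine norm_sum_le_of_le _ (fun s _ => ?_) |>.trans_eq (Finset.sum_const _)
    rw [← Finset.sum_subset (Finset.filter_subset _ _ : closePairs H L (d * a) ⊆ _)]
    · rw [← nsmul_eq_mul]
      exact norm_sum_le_of_le _ (fun t _ => norm_sum_mulDiff_mulDiff_le hL hf1 _ _)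
        |>.trans_eq (Finset.sum_const _)
    · intro t ht hclose
      have hshift : d * a * (t.1 - t.2) ∉ Finset.Ioo (-L) L :=
        fun h => hclose (Finset.mem_filter.2 ⟨ht, h⟩)
      simp [mulDiff_eq_zero_of_shift_notMem hf hshift, mulDiff_zero]
  · intro s hs hclose
    have hshift : d * (a + b) * (s.1 - s.2) ∉ Finset.Ioo (-L) L :=
      fun h => hclose (Finset.mem_filter.2 ⟨hs, h⟩)
    simp [mulDiff_eq_zero_of_shift_notMem (mulDiff_eq_zero_of_notMem hf _) hshift]

theorem norm_boxSum_le {A H b d : ℤ} (hA : 0 ≤ A) (hH : 0 ≤ H) (hL : 0 ≤ L)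
    (hf1 : IsOneBounded f) (hf : ∀ x ∉ Finset.Icc 1 L, f x = 0) :
    ‖boxSum d A H L b f‖ ≤ A * H ^ 4 * L := by
  calc ‖boxSum d A H L b f‖
      ≤ ∑ a ∈ Finset.Icc 1 A,
          ((closePairs H L (d * (a + b))).card : ℝ) * (closePairs H L (d * a)).card * L :=
        norm_boxSum_le_sum_card hL hf1 hf
    _ ≤ ∑ _ ∈ Finset.Icc 1 A, (H : ℝ) ^ 2 * H ^ 2 * L := by
        gcongr
        · exact card_closePairs_le_sq hH _ _
        · exact card_closePairs_le_sq hH _ _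
    _ = A * H ^ 4 * L := by
        rw [Finset.sum_const, nsmul_eq_mul, natCast_card_Icc_one hA]
        ring

theorem card_filter_cast_le_le (A : ℤ) {t : ℝ} (ht : 0 ≤ t) :
    (((Finset.Icc 1 A).filter fun a : ℤ => (a : ℝ) ≤ t).card : ℝ) ≤ t := by
  have subset : ((Finset.Icc 1 A).filter fun a : ℤ => (a : ℝ) ≤ t) ⊆ Finset.Icc 1 ⌊t⌋ := by
    intro a ha
    rw [Finset.mem_filter, Finset.mem_Icc] at ha
    exact Finset.mem_Icc.2 ⟨ha.1.1, Int.le_floor.2 ha.2⟩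
  calc _ ≤ ((Finset.Icc 1 ⌊t⌋).card : ℝ) := by exact_mod_cast Finset.card_le_card subset
    _ = ⌊t⌋ := natCast_card_Icc_one (Int.floor_nonneg.2 ht)
    _ ≤ t := Int.floor_le _

theorem card_closePairs_two_mul_le {A H c : ℤ} {η : ℝ} (hA : 0 < A) (hH : 0 ≤ H) (hL : 0 ≤ L)
    (hη : 0 < η) (hc : η * A < c) :
    ((closePairs H L (2 * c)).card : ℝ) ≤ H * (L / (η * A) + 1) := by
  have hc0 : (0 : ℝ) < c := lt_trans (by positivity) hc
  refine (card_closePairs_le hH hL (by exact_mod_cast mul_pos two_pos hc0)).trans ?_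
  rw [Int.cast_mul, Int.cast_ofNat, mul_div_mul_left _ _ two_ne_zero]
  gcongr

/-- This improves on `norm_boxSum_le` when the progressions are longer than the support of `f`. -/
theorem norm_boxSum_le_of_long {A H b : ℤ} (hA : 0 < A) (hH : 0 ≤ H) (hL : 0 ≤ L) (hb : 0 ≤ b)
    (hf1 : IsOneBounded f) (hf : ∀ x ∉ Finset.Icc 1 L, f x = 0) {η : ℝ} (hη : 0 < η) :
    ‖boxSum 2 A H L b f‖ ≤ A * H ^ 2 * L * (η * H ^ 2 + (L / (η * A) + 1) ^ 2) := by
  have hb' : (0 : ℝ) ≤ b := by exact_mod_cast hb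
  have summand_le : ∀ a ∈ Finset.Icc 1 A,
      ((closePairs H L (2 * (a + b))).card : ℝ) * (closePairs H L (2 * a)).card * L ≤
        H ^ 2 * L * ((if (a : ℝ) ≤ η * A then 1 else 0) * H ^ 2 + (L / (η * A) + 1) ^ 2) := by
    intro a _
    split_ifs with hsmall
    · calc _ ≤ (H : ℝ) ^ 2 * H ^ 2 * L := by
            gcongr
            · exact card_closePairs_le_sq hH _ _
            · exact card_closePairs_le_sq hH _ _
        _ = H ^ 2 * L * (1 * H ^ 2 + 0) := by ring
        _ ≤ _ := by gcongr; positivity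
    · rw [not_le] at hsmall
      calc _ ≤ (H * ((L : ℝ) / (η * A) + 1)) * (H * (L / (η * A) + 1)) * L := by
            gcongr
            · exact card_closePairs_two_mul_le hA hH hL hη (by push_cast; linarith)
            · exact card_closePairs_two_mul_le hA hH hL hη hsmall
        _ = _ := by ring
  calc ‖boxSum 2 A H L b f‖
      ≤ ∑ a ∈ Finset.Icc 1 A,
          H ^ 2 * L * ((if (a : ℝ) ≤ η * A then 1 else 0) * H ^ 2 + (L / (η * A) + 1) ^ 2) :=
        (norm_boxSum_le_sum_card hL hf1 hf).trans (Finset.sum_le_sum summand_le)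
    _ = H ^ 2 * L * (((Finset.Icc 1 A).filter fun a : ℤ => (a : ℝ) ≤ η * A).card * H ^ 2 +
          A * (L / (η * A) + 1) ^ 2) := by
        rw [← Finset.mul_sum, Finset.sum_add_distrib, ← Finset.sum_mul, Finset.sum_boole,
          Finset.sum_const, nsmul_eq_mul, natCast_card_Icc_one hA.le]
    _ ≤ H ^ 2 * L * (η * A * H ^ 2 + A * (L / (η * A) + 1) ^ 2) := by
        gcongr
        exact card_filter_cast_le_le A (by positivity)
    _ = _ := by ring

end BoxAverage

section Parameters

variable {A H L M δ₂ δ₃ δ₄ : ℝ}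

/-- The density `θ` at which `pow_mul_le_gowersNorm_three_pow` is applied when the box average
with shifts in `[δ₃ M]` is at least `δ₄ M⁴`. The true density is of order `δ₄`; passing to the much
smaller `θ` makes the size conditions `θ ^ 2 * L ≤ H ^ 2` and `θ ^ 2 * L ≤ H * A` hold. -/
noncomputable def boxScale (δ₃ δ₄ : ℝ) : ℝ := 1 / 2 ^ 20 * (δ₃ * δ₄) ^ 2

theorem boxScale_pos (h₃ : 0 < δ₃) (h₄ : 0 < δ₄) : 0 < boxScale δ₃ δ₄ := by
  unfold boxScale
  positivity

theorem mul_sq_le_or_cube_mul_sq_le (hA : 0 < A) (hH : 0 < H) (hL : 0 < L) (h₄ : 0 < δ₄)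
    (h : δ₄ / 2 * A * H ^ 4 * L ≤
      A * H ^ 2 * L * (δ₄ / 4 * H ^ 2 + (L / (δ₄ / 4 * A) + 1) ^ 2)) :
    δ₄ * H ^ 2 ≤ 16 ∨ δ₄ ^ 3 * (H * A) ^ 2 ≤ 256 * L ^ 2 := by
  have hw0 : 0 < L / (δ₄ / 4 * A) := by positivity
  have h' : (A * H ^ 2 * L) * (δ₄ / 2 * H ^ 2) ≤
      A * H ^ 2 * L * (δ₄ / 4 * H ^ 2 + (L / (δ₄ / 4 * A) + 1) ^ 2) := by
    calc _ = δ₄ / 2 * A * H ^ 4 * L := by ring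
      _ ≤ _ := h
  have hquad := le_of_mul_le_mul_left h' (by positivity)
  rcases le_or_gt (L / (δ₄ / 4 * A)) 1 with hw | hw
  · left
    nlinarith
  · right
    have hbound : δ₄ / 4 * H ^ 2 ≤ 4 * (L / (δ₄ / 4 * A)) ^ 2 := by nlinarith
    have hclear : δ₄ / 4 * H ^ 2 * (δ₄ / 4 * A) ^ 2 ≤ 4 * L ^ 2 := by
      rwa [div_pow, ← mul_div_assoc, le_div_iff₀ (by positivity)] at hbound
    linarith

theorem mul_sq_le_of_cube_mul_sq_mul_sq_le (h₂ : 0 < δ₂) (h₃ : 0 < δ₃) (h₄ : 0 < δ₄)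
    (h₄' : δ₄ ≤ 2) (hδ : δ₃ < 1 / 2 ^ 21 * δ₂ ^ 3 * δ₄ ^ 4)
    (h : δ₄ ^ 3 * δ₂ ^ 2 * δ₃ ^ 2 ≤ 2 ^ 14) : δ₄ * δ₃ ^ 2 ≤ 64 := by
  rcases le_or_gt δ₃ 1 with h1 | h1
  · calc δ₄ * δ₃ ^ 2 ≤ 2 * 1 ^ 2 := by gcongr
      _ ≤ _ := by norm_num
  · calc δ₄ * δ₃ ^ 2 ≤ δ₄ * δ₃ ^ 8 := by gcongr; exacts [h1.le, by norm_num]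
      _ = δ₄ * δ₃ ^ 6 * δ₃ ^ 2 := by ring
      _ ≤ δ₄ * δ₃ ^ 6 * (1 / 2 ^ 21 * δ₂ ^ 3 * δ₄ ^ 4) ^ 2 := by gcongr
      _ = 1 / 2 ^ 42 * (δ₄ ^ 3 * δ₂ ^ 2 * δ₃ ^ 2) ^ 3 := by ring
      _ ≤ 1 / 2 ^ 42 * (2 ^ 14) ^ 3 := by gcongr
      _ ≤ 64 := by norm_num

theorem mul_sq_le_of_mul_sq_le_or (hM : 1 ≤ M) (hL : 0 < L) (hA : δ₂ * M ≤ 2 * A)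
    (hH : δ₃ * M ≤ 2 * H) (hLM : L ≤ 2 * M ^ 2) (h₂ : 0 < δ₂) (h₃ : 0 < δ₃) (h₄ : 0 < δ₄)
    (h₄' : δ₄ ≤ 2) (hδ : δ₃ < 1 / 2 ^ 21 * δ₂ ^ 3 * δ₄ ^ 4)
    (h : δ₄ * H ^ 2 ≤ 16 ∨ δ₄ ^ 3 * (H * A) ^ 2 ≤ 256 * L ^ 2) : δ₄ * δ₃ ^ 2 ≤ 64 := by
  rcases h with h | h
  · calc δ₄ * δ₃ ^ 2 = δ₄ * (δ₃ * 1) ^ 2 := by ring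
      _ ≤ δ₄ * (δ₃ * M) ^ 2 := by gcongr
      _ ≤ δ₄ * (2 * H) ^ 2 := by gcongr
      _ = 4 * (δ₄ * H ^ 2) := by ring
      _ ≤ 4 * 16 := by gcongr
      _ = 64 := by norm_num
  · refine mul_sq_le_of_cube_mul_sq_mul_sq_le h₂ h₃ h₄ h₄' hδ ?_
    have _ : 0 < 2 * H := lt_of_lt_of_le (by positivity) hH
    refine le_of_mul_le_mul_right (a := M ^ 4) ?_ (by positivity)
    calc δ₄ ^ 3 * δ₂ ^ 2 * δ₃ ^ 2 * M ^ 4 = δ₄ ^ 3 * ((δ₃ * M) * (δ₂ * M)) ^ 2 := by ring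
      _ ≤ δ₄ ^ 3 * ((2 * H) * (2 * A)) ^ 2 := by gcongr
      _ = 16 * (δ₄ ^ 3 * (H * A) ^ 2) := by ring
      _ ≤ 16 * (256 * L ^ 2) := by gcongr
      _ ≤ 16 * (256 * (2 * M ^ 2) ^ 2) := by gcongr
      _ = 2 ^ 14 * M ^ 4 := by ring

theorem boxScale_le_mul (h₄ : 0 < δ₄) (h : δ₄ * δ₃ ^ 2 ≤ 64) :
    boxScale δ₃ δ₄ ≤ 1 / 2 ^ 14 * δ₄ := by
  calc boxScale δ₃ δ₄ = 1 / 2 ^ 20 * (δ₄ * (δ₄ * δ₃ ^ 2)) := by rw [boxScale]; ring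
    _ ≤ 1 / 2 ^ 20 * (δ₄ * 64) := by gcongr
    _ = _ := by ring

theorem boxScale_le (h₄ : 0 < δ₄) (h₄' : δ₄ ≤ 2) (h : δ₄ * δ₃ ^ 2 ≤ 64) :
    boxScale δ₃ δ₄ ≤ 1 / 1000 := by
  linarith [boxScale_le_mul h₄ h]

theorem boxScale_sq_mul_le_sq (hH : δ₃ * M ≤ 2 * H) (hLM : L ≤ 2 * M ^ 2) (hM : 0 < M)
    (h₃ : 0 < δ₃) (h₄ : 0 < δ₄) (h₄' : δ₄ ≤ 2) (h : δ₄ * δ₃ ^ 2 ≤ 64) :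
    boxScale δ₃ δ₄ ^ 2 * L ≤ H ^ 2 := by
  calc boxScale δ₃ δ₄ ^ 2 * L ≤ boxScale δ₃ δ₄ ^ 2 * (2 * M ^ 2) := by gcongr
    _ = 1 / 2 ^ 39 * (δ₄ * δ₃ ^ 2) * δ₄ ^ 3 * (δ₃ * M) ^ 2 := by rw [boxScale]; ring
    _ ≤ 1 / 2 ^ 39 * 64 * 2 ^ 3 * (2 * H) ^ 2 := by gcongr
    _ = 1 / 2 ^ 28 * H ^ 2 := by ring
    _ ≤ 1 * H ^ 2 := by gcongr; norm_num
    _ = H ^ 2 := one_mul _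

theorem boxScale_sq_le_mul (h₂ : 0 < δ₂) (h₃ : 0 < δ₃) (h₄ : 0 < δ₄) (h₄' : δ₄ ≤ 2)
    (hδ : δ₃ < 1 / 2 ^ 21 * δ₂ ^ 3 * δ₄ ^ 4) (h : δ₄ * δ₃ ^ 2 ≤ 64) :
    8 * boxScale δ₃ δ₄ ^ 2 ≤ δ₂ * δ₃ := by
  refine le_of_pow_le_pow_left₀ (n := 3) (by norm_num) (by positivity) ?_
  calc (8 * boxScale δ₃ δ₄ ^ 2) ^ 3
      = 1 / 2 ^ 111 * (δ₄ * δ₃ ^ 2) ^ 4 * δ₄ ^ 8 * (δ₃ ^ 3 * δ₃) := by rw [boxScale]; ring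
    _ ≤ 1 / 2 ^ 111 * 64 ^ 4 * 2 ^ 8 * (δ₃ ^ 3 * (1 / 2 ^ 21 * δ₂ ^ 3 * δ₄ ^ 4)) := by
        gcongr
    _ ≤ 1 / 2 ^ 111 * 64 ^ 4 * 2 ^ 8 * (δ₃ ^ 3 * (1 / 2 ^ 21 * δ₂ ^ 3 * 2 ^ 4)) := by
        gcongr
    _ = 1 / 2 ^ 96 * (δ₂ * δ₃) ^ 3 := by ring
    _ ≤ 1 * (δ₂ * δ₃) ^ 3 := by gcongr; norm_num
    _ = _ := one_mul _

theorem boxScale_sq_mul_le_mul (hA : δ₂ * M ≤ 2 * A) (hH : δ₃ * M ≤ 2 * H)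
    (hLM : L ≤ 2 * M ^ 2) (hM : 0 < M) (h₂ : 0 < δ₂) (h₃ : 0 < δ₃) (h₄ : 0 < δ₄)
    (h₄' : δ₄ ≤ 2) (hδ : δ₃ < 1 / 2 ^ 21 * δ₂ ^ 3 * δ₄ ^ 4) (h : δ₄ * δ₃ ^ 2 ≤ 64) :
    boxScale δ₃ δ₄ ^ 2 * L ≤ H * A := by
  have _ : 0 < 2 * H := lt_of_lt_of_le (by positivity) hH
  calc boxScale δ₃ δ₄ ^ 2 * L ≤ boxScale δ₃ δ₄ ^ 2 * (2 * M ^ 2) := by gcongr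
    _ = 1 / 4 * (8 * boxScale δ₃ δ₄ ^ 2 * M ^ 2) := by ring
    _ ≤ 1 / 4 * (δ₂ * δ₃ * M ^ 2) := by
        gcongr 1 / 4 * (?_ * M ^ 2)
        exact boxScale_sq_le_mul h₂ h₃ h₄ h₄' hδ h
    _ = 1 / 4 * ((δ₃ * M) * (δ₂ * M)) := by ring
    _ ≤ 1 / 4 * ((2 * H) * (2 * A)) := by gcongr
    _ = H * A := by ring

end Parameters

section FixedShift

variable {M δ₂ δ₃ δ₄ : ℝ} {b : ℤ} {f : ℤ → ℂ}

theorem floor_pos_of_boxAverage_pos {q : ℕ} {L : ℤ} (hf : ∀ x ∉ Finset.Icc 1 L, f x = 0)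
    (h : 0 < boxAverage q δ₂ δ₃ M b f) : 1 ≤ ⌊δ₂ * M⌋ ∧ 1 ≤ ⌊δ₃ * M⌋ ∧ 1 ≤ L := by
  have hA : 1 ≤ ⌊δ₂ * M⌋ := by
    by_contra hlt
    simp [boxAverage, initInterval, Finset.Icc_eq_empty hlt] at h
  rw [boxAverage_eq hf q hA] at h
  refine ⟨hA, ?_, ?_⟩ <;>
  · by_contra hlt
    simp [boxSum, Finset.Icc_eq_empty hlt] at h

theorem le_two_mul_floor {x : ℝ} (h : 1 ≤ ⌊x⌋) : x ≤ 2 * ⌊x⌋ := by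
  have : (1 : ℝ) ≤ ⌊x⌋ := by exact_mod_cast h
  linarith [Int.lt_floor_add_one x]

theorem le_floor_two_mul {x : ℝ} (h : 1 ≤ x) : x ≤ ⌊2 * x⌋ := by
  linarith [Int.lt_floor_add_one (2 * x)]

theorem boxAverage_le (hM : 0 < M) (h₃ : 0 < δ₃) (hA : 1 ≤ ⌊δ₂ * M⌋)
    (hf1 : IsOneBounded f) (hf : ∀ x ∉ Finset.Icc 1 ⌊2 * M ^ 2⌋, f x = 0) :
    boxAverage 1 δ₂ δ₃ M b f ≤ 2 * M ^ 4 := by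
  rcases le_or_gt (boxAverage 1 δ₂ δ₃ M b f) 0 with h | h
  · exact h.trans (by positivity)
  obtain ⟨-, hH, hL⟩ := floor_pos_of_boxAverage_pos hf h
  rw [boxAverage_eq hf 1 hA, div_le_iff₀ (by positivity)]
  calc _ ≤ ‖boxSum (2 * (1 : ℕ)) ⌊δ₂ * M⌋ ⌊δ₃ * M⌋ ⌊2 * M ^ 2⌋ b f‖ := Complex.re_le_norm _
    _ ≤ ⌊δ₂ * M⌋ * (⌊δ₃ * M⌋ : ℝ) ^ 4 * ⌊2 * M ^ 2⌋ :=
        norm_boxSum_le (by omega) (by omega) (by omega) hf1 hf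
    _ ≤ ⌊δ₂ * M⌋ * (δ₃ * M) ^ 4 * (2 * M ^ 2) := by
        gcongr <;> exact Int.floor_le _
    _ = _ := by ring

theorem le_two_of_le_boxAverage (hM : 0 < M) (h₃ : 0 < δ₃) (hA : 1 ≤ ⌊δ₂ * M⌋)
    (hf1 : IsOneBounded f) (hf : ∀ x ∉ Finset.Icc 1 ⌊2 * M ^ 2⌋, f x = 0)
    (h : δ₄ * M ^ 4 ≤ boxAverage 1 δ₂ δ₃ M b f) : δ₄ ≤ 2 :=
  le_of_mul_le_mul_right (h.trans (boxAverage_le hM h₃ hA hf1 hf)) (by positivity)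

theorem le_norm_boxSum_of_le_boxAverage (hM : 0 < M) (h₃ : 0 < δ₃) (h₄ : 0 < δ₄)
    (hf : ∀ x ∉ Finset.Icc 1 ⌊2 * M ^ 2⌋, f x = 0)
    (h : δ₄ * M ^ 4 ≤ boxAverage 1 δ₂ δ₃ M b f) :
    δ₄ / 2 * ⌊δ₂ * M⌋ * (⌊δ₃ * M⌋ : ℝ) ^ 4 * ⌊2 * M ^ 2⌋ ≤
      ‖boxSum 2 ⌊δ₂ * M⌋ ⌊δ₃ * M⌋ ⌊2 * M ^ 2⌋ b f‖ := by
  obtain ⟨hA, hH, -⟩ := floor_pos_of_boxAverage_pos hf (lt_of_lt_of_le (by positivity) h)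
  rw [boxAverage_eq hf 1 hA, le_div_iff₀ (by positivity), Nat.cast_one, mul_one 2] at h
  calc _ ≤ δ₄ / 2 * ⌊δ₂ * M⌋ * (δ₃ * M) ^ 4 * (2 * M ^ 2) := by
        gcongr <;> exact Int.floor_le _
    _ = δ₄ * M ^ 4 * (⌊δ₂ * M⌋ * (δ₃ ^ 2 * M) ^ 2) := by ring
    _ ≤ _ := h
    _ ≤ _ := Complex.re_le_norm _

theorem mul_sq_le_of_le_boxAverage (hM : 1 ≤ M) (h₂ : 0 < δ₂) (h₃ : 0 < δ₃) (h₄ : 0 < δ₄)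
    (hδ : δ₃ < 1 / 2 ^ 21 * δ₂ ^ 3 * δ₄ ^ 4) (hb : 0 ≤ b) (hf1 : IsOneBounded f)
    (hf : ∀ x ∉ Finset.Icc 1 ⌊2 * M ^ 2⌋, f x = 0)
    (h : δ₄ * M ^ 4 ≤ boxAverage 1 δ₂ δ₃ M b f) : δ₄ * δ₃ ^ 2 ≤ 64 := by
  obtain ⟨hA, hH, hL⟩ := floor_pos_of_boxAverage_pos hf (lt_of_lt_of_le (by positivity) h)
  have hA0 : (0 : ℝ) < ⌊δ₂ * M⌋ := by exact_mod_cast hA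
  have hH0 : (0 : ℝ) < ⌊δ₃ * M⌋ := by exact_mod_cast hH
  have hL0 : (0 : ℝ) < ⌊2 * M ^ 2⌋ := by exact_mod_cast hL
  exact mul_sq_le_of_mul_sq_le_or hM hL0 (le_two_mul_floor hA) (le_two_mul_floor hH)
    (Int.floor_le _) h₂ h₃ h₄ (le_two_of_le_boxAverage (by linarith) h₃ hA hf1 hf h) hδ <|
    mul_sq_le_or_cube_mul_sq_le hA0 hH0 hL0 h₄ <|
    (le_norm_boxSum_of_le_boxAverage (by linarith) h₃ h₄ hf h).trans <|
    norm_boxSum_le_of_long (by omega) (by omega) (by omega) hb hf1 hf (by positivity)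

theorem pow_mul_le_gowersNorm_four_pow {L : ℤ} {θ : ℝ} (hL : 1 ≤ L) (hθ : 0 < θ)
    (hθ1 : θ ≤ 1 / 1000) (hf : ∀ x ∉ Finset.Icc 1 L, f x = 0) {n : ℕ}
    (h : θ ^ n * L ^ 4 ≤ gowersNorm 3 f ^ 2 ^ 3) :
    θ ^ (2 * n + 1) * L ^ 5 ≤ gowersNorm 4 f ^ 2 ^ 4 := by
  refine le_of_mul_le_mul_left (a := 8 * (L : ℝ) ^ 3) ?_ (by positivity)
  calc 8 * (L : ℝ) ^ 3 * (θ ^ (2 * n + 1) * L ^ 5)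
      ≤ 1000 * (L : ℝ) ^ 3 * (θ ^ (2 * n + 1) * L ^ 5) := by gcongr; norm_num
    _ = (1000 * θ ^ (2 * n + 1)) * L ^ 8 := by ring
    _ ≤ θ ^ (2 * n) * L ^ 8 := by gcongr; exact mul_pow_succ_le hθ hθ1 _
    _ = (θ ^ n * L ^ 4) ^ 2 := by ring
    _ ≤ (gowersNorm 3 f ^ 2 ^ 3) ^ 2 := by gcongr
    _ ≤ (2 * L) ^ 3 * gowersNorm 4 f ^ 2 ^ 4 := gowersNorm_succ_pow_sq_le 2 (by omega) hf
    _ = _ := by ring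

theorem boxScale_pow_mul_le_gowersNorm_four_pow (hM : 1 ≤ M) (h₂ : 0 < δ₂) (h₃ : 0 < δ₃)
    (h₄ : 0 < δ₄) (hδ : δ₃ < 1 / 2 ^ 21 * δ₂ ^ 3 * δ₄ ^ 4) (hb : b ∈ initInterval (δ₂ * M))
    (hf1 : IsOneBounded f) (hf : ∀ x ∉ Finset.Icc 1 ⌊2 * M ^ 2⌋, f x = 0)
    (h : δ₄ * M ^ 4 ≤ boxAverage 1 δ₂ δ₃ M b f) :
    boxScale δ₃ δ₄ ^ 4027 * (M ^ 2) ^ 5 ≤ gowersNorm 4 f ^ 2 ^ 4 := by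
  have hM0 : 0 < M := by linarith
  rw [initInterval, Finset.mem_Icc] at hb
  obtain ⟨hA, hH, hL⟩ := floor_pos_of_boxAverage_pos hf (lt_of_lt_of_le (by positivity) h)
  have h64 := mul_sq_le_of_le_boxAverage hM h₂ h₃ h₄ hδ (by omega) hf1 hf h
  have hδ₄ := le_two_of_le_boxAverage hM0 h₃ hA hf1 hf h
  have hAM := le_two_mul_floor hA
  have hHM := le_two_mul_floor hH
  have hLM := Int.floor_le (2 * M ^ 2)
  have hθ0 := boxScale_pos h₃ h₄
  have hθ1 := boxScale_le h₄ hδ₄ h64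
  have hθ₄ : boxScale δ₃ δ₄ ≤ δ₄ / 2 := by linarith [boxScale_le_mul h₄ h64]
  have h_three : boxScale δ₃ δ₄ ^ 2013 * (⌊2 * M ^ 2⌋ : ℝ) ^ 4 ≤ gowersNorm 3 f ^ 2 ^ 3 :=
    pow_mul_le_gowersNorm_three_pow hf1 hf hA hH hL (by omega) hb.2 hθ0 hθ1
      (boxScale_sq_mul_le_sq hHM hLM hM0 h₃ h₄ hδ₄ h64)
      (boxScale_sq_mul_le_mul hAM hHM hLM hM0 h₂ h₃ h₄ hδ₄ hδ h64)
      (le_trans (by gcongr) (le_norm_boxSum_of_le_boxAverage hM0 h₃ h₄ hf h))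
  calc _ ≤ boxScale δ₃ δ₄ ^ 4027 * (⌊2 * M ^ 2⌋ : ℝ) ^ 5 := by
        gcongr
        exact le_floor_two_mul (one_le_pow₀ hM)
    _ ≤ _ := pow_mul_le_gowersNorm_four_pow hL hθ0 hθ1 hf h_three

end FixedShift

/-- The restriction of `f` to the residue class of `u` modulo `q`, rescaled to `ℤ` so that `u`
is placed at `1`; for `1 ≤ u ≤ q` this maps `[1, q m]` onto `[1, m]`. -/
def residueRescale (q : ℕ) (u : ℤ) (f : ℤ → ℂ) : ℤ → ℂ := fun y => f (u + q * (y - 1))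

section Residues

theorem residueRescale_mulDiff (q : ℕ) (u h : ℤ) (f : ℤ → ℂ) :
    residueRescale q u (mulDiff (q * h) f) = mulDiff h (residueRescale q u f) := by
  funext y
  simp only [residueRescale, mulDiff]
  congr 2
  ring

theorem residueRescale_mulDiffs (q : ℕ) (u : ℤ) (f : ℤ → ℂ) (hs : List ℤ) :
    residueRescale q u (mulDiffs (hs.map (q * ·)) f) = mulDiffs hs (residueRescale q u f) := by
  induction hs with
  | nil => rfl
  | cons h hs ih =>
    exact (residueRescale_mulDiff q u h _).trans (congrArg (mulDiff h) ih)

variable {q : ℕ} {n m : ℤ}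

theorem residueRescale_eq_zero (hm : n ≤ q * m) {f : ℤ → ℂ} (hf : ∀ x ∉ Finset.Icc 1 n, f x = 0)
    {u : ℤ} (hu : u ∈ Finset.Icc 1 (q : ℤ)) :
    ∀ y ∉ Finset.Icc 1 m, residueRescale q u f y = 0 := by
  intro y hy
  refine hf _ fun h => hy ?_
  rw [Finset.mem_Icc] at h hu ⊢
  constructor <;> nlinarith

theorem sum_Icc_mul_eq_sum_sum_residueRescale (hq : 0 < q) (g : ℤ → ℂ) :
    ∑ x ∈ Finset.Icc 1 (q * m), g x =
      ∑ u ∈ Finset.Icc 1 (q : ℤ), ∑ y ∈ Finset.Icc 1 m, residueRescale q u g y := by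
  have hq0 : (0 : ℤ) < q := by exact_mod_cast hq
  rw [← Finset.sum_product']
  refine Finset.sum_nbij' (fun x => ((x - 1) % q + 1, (x - 1) / q + 1))
    (fun t => t.1 + q * (t.2 - 1)) ?_ ?_ ?_ ?_ ?_
  · intro x h
    simp only [Finset.mem_product, Finset.mem_Icc] at h ⊢
    have emod_nonneg := Int.emod_nonneg (x - 1) hq0.ne'
    have emod_lt := Int.emod_lt_of_pos (x - 1) hq0
    have ediv_nonneg := Int.ediv_nonneg (by omega : 0 ≤ x - 1) hq0.le
    have ediv_lt : (x - 1) / q < m := (Int.ediv_lt_iff_lt_mul hq0).2 (by linarith)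
    omega
  · rintro ⟨u, y⟩ h
    simp only [Finset.mem_product, Finset.mem_Icc] at h ⊢
    constructor <;> nlinarith
  · intro x _
    linarith [Int.mul_ediv_add_emod (x - 1) q]
  · rintro ⟨u, y⟩ h
    simp only [Finset.mem_product, Finset.mem_Icc] at h
    have e : u + q * (y - 1) - 1 = (u - 1) + q * (y - 1) := by ring
    simp only [e, Int.add_mul_emod_self_left, Int.add_mul_ediv_left _ _ hq0.ne',
      Int.emod_eq_of_lt (by omega : 0 ≤ u - 1) (by omega : u - 1 < q),
      Int.ediv_eq_zero_of_lt (by omega : 0 ≤ u - 1) (by omega : u - 1 < q)]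
    simp
  · intro x _
    simp only [residueRescale]
    congr 1
    linarith [Int.mul_ediv_add_emod (x - 1) q]

theorem sum_Icc_eq_sum_sum_residueRescale (hq : 0 < q) (hm : n ≤ q * m) {g : ℤ → ℂ}
    (hg : ∀ x ∉ Finset.Icc 1 n, g x = 0) :
    ∑ x ∈ Finset.Icc 1 n, g x =
      ∑ u ∈ Finset.Icc 1 (q : ℤ), ∑ y ∈ Finset.Icc 1 m, residueRescale q u g y := by
  rw [← sum_Icc_mul_eq_sum_sum_residueRescale hq]
  exact Finset.sum_subset (Finset.Icc_subset_Icc le_rfl hm) fun x _ hx => hg x hx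

theorem boxSum_eq_sum_residueRescale (hq : 0 < q) (hm : n ≤ q * m) {f : ℤ → ℂ}
    (hf : ∀ x ∉ Finset.Icc 1 n, f x = 0) (d A H b : ℤ) :
    boxSum (d * q) A H n b f =
      ∑ u ∈ Finset.Icc 1 (q : ℤ), boxSum d A H m b (residueRescale q u f) := by
  have inner_sum : ∀ k l : ℤ, ∑ x ∈ Finset.Icc 1 n, mulDiff (q * k) (mulDiff (q * l) f) x =
      ∑ u ∈ Finset.Icc 1 (q : ℤ), ∑ y ∈ Finset.Icc 1 m,
        mulDiff k (mulDiff l (residueRescale q u f)) y := by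
    intro k l
    rw [sum_Icc_eq_sum_sum_residueRescale hq hm
      (mulDiff_eq_zero_of_notMem (mulDiff_eq_zero_of_notMem hf (q * l)) (q * k))]
    simp only [residueRescale_mulDiff]
  simp only [boxSum, mul_comm d (q : ℤ), mul_assoc (q : ℤ), inner_sum]
  symm
  rw [Finset.sum_comm]
  refine Finset.sum_congr rfl fun a _ => ?_
  rw [Finset.sum_comm]
  refine Finset.sum_congr rfl fun s _ => ?_
  rw [Finset.sum_comm]

theorem boxAverage_eq_sum_residueRescale (hq : 0 < q) (hm : n ≤ q * m) {f : ℤ → ℂ}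
    (hf : ∀ x ∉ Finset.Icc 1 n, f x = 0) {δ δ' M : ℝ} (hA : 1 ≤ ⌊δ * M⌋) (b : ℤ) :
    boxAverage q δ δ' M b f =
      ∑ u ∈ Finset.Icc 1 (q : ℤ), boxAverage 1 δ δ' M b (residueRescale q u f) := by
  rw [boxAverage_eq hf q hA, boxSum_eq_sum_residueRescale hq hm hf, Complex.re_sum,
    Finset.sum_div]
  refine Finset.sum_congr rfl fun u hu => ?_
  rw [boxAverage_eq (residueRescale_eq_zero hm hf hu) 1 hA b, Nat.cast_one, mul_one 2]

theorem ne_zero_of_mulDiffs_ne_zero {g : ℤ → ℂ} {hs : List ℤ} {x : ℤ}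
    (h : mulDiffs hs g x ≠ 0) : g x ≠ 0 ∧ ∀ k ∈ hs, g (x + k) ≠ 0 := by
  induction hs generalizing x with
  | nil => exact ⟨h, by simp⟩
  | cons k hs ih =>
    change mulDiffs hs g (x + k) * (starRingEnd ℂ) (mulDiffs hs g x) ≠ 0 at h
    rw [mul_ne_zero_iff, map_ne_zero] at h
    exact ⟨(ih h.2).1, List.forall_mem_cons.2 ⟨(ih h.1).1, (ih h.2).2⟩⟩

theorem support_mulDiffs_indicator_subset (s : ℕ) (q : ℕ) (u : ℤ) (f : ℤ → ℂ) :
    (Function.support fun p : ℤ × (Fin s → ℤ) =>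
        mulDiffs (List.ofFn p.2) ((residueClass q u).indicator f) p.1) ⊆
      Set.range fun p : ℤ × (Fin s → ℤ) => (u + q * (p.1 - 1), fun i => q * p.2 i) := by
  rintro ⟨x, h⟩ hp
  obtain ⟨hx, hxh⟩ := ne_zero_of_mulDiffs_ne_zero (Function.mem_support.1 hp)
  obtain ⟨k, hk⟩ := Set.mem_of_indicator_ne_zero hx
  have dvd : ∀ i, ∃ l : ℤ, h i = q * l := by
    intro i
    obtain ⟨k', hk'⟩ := Set.mem_of_indicator_ne_zero (hxh (h i) (by simp [List.mem_ofFn]))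
    exact ⟨k' - k, by rw [mul_sub]; linarith⟩
  choose l hl using dvd
  exact ⟨(k + 1, l), Prod.ext (by simpa using hk.symm) (funext fun i => (hl i).symm)⟩

theorem residueRescale_indicator_residueClass (q : ℕ) (u : ℤ) (f : ℤ → ℂ) :
    residueRescale q u ((residueClass q u).indicator f) = residueRescale q u f :=
  funext fun y => Set.indicator_of_mem (s := residueClass q u) ⟨y - 1, rfl⟩ f

theorem gowersNormOn_residueClass (s : ℕ) (hq : 0 < q) (u : ℤ) (f : ℤ → ℂ) :
    gowersNormOn s (residueClass q u) f = gowersNorm s (residueRescale q u f) := by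
  have hq0 : (q : ℤ) ≠ 0 := by exact_mod_cast hq.ne'
  have rescale_injective : Function.Injective
      fun p : ℤ × (Fin s → ℤ) => (u + q * (p.1 - 1), fun i => q * p.2 i) := by
    rintro ⟨x, h⟩ ⟨x', h'⟩ heq
    simp only [Prod.mk.injEq, add_right_inj] at heq
    exact Prod.ext (sub_left_injective (mul_left_cancel₀ hq0 heq.1))
      (funext fun i => mul_left_cancel₀ hq0 (congrFun heq.2 i))
  rw [gowersNormOn, gowersNorm, gowersNorm, ← residueRescale_indicator_residueClass,
    ← rescale_injective.tsum_eq (support_mulDiffs_indicator_subset s q u f)]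
  congr 3
  funext p
  rw [← residueRescale_mulDiffs, List.map_ofFn]
  rfl

end Residues

theorem mul_le_expect_of_mul_le_expect {ι : Type*} {s : Finset ι} {a G : ι → ℝ} {m c κ : ℝ}
    (hs : s.Nonempty) (hm : 0 < m) (hκ : 0 < κ) (hc : 0 ≤ c) (hG : ∀ i ∈ s, 0 ≤ G i)
    (ha : ∀ i ∈ s, a i ≤ 2 * m) (large_of_large : ∀ i ∈ s, c / 2 * m ≤ a i → κ ≤ G i)
    (h : c * m ≤ 𝔼 i ∈ s, a i) : c / 4 * κ ≤ 𝔼 i ∈ s, G i := by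
  have pointwise : ∀ i ∈ s, a i ≤ c / 2 * m + 2 * m / κ * G i := by
    intro i hi
    rcases le_or_gt (c / 2 * m) (a i) with hlarge | hsmall
    · calc a i ≤ 0 + 2 * m / κ * κ := by
            rw [zero_add, div_mul_cancel₀ _ hκ.ne']
            exact ha i hi
        _ ≤ _ := by
            gcongr
            · positivity
            · exact large_of_large i hi hlarge
    · linarith [mul_nonneg (by positivity : 0 ≤ 2 * m / κ) (hG i hi)]
  have averaged := h.trans (Finset.expect_le_expect pointwise)
  rw [Finset.expect_add_distrib, Finset.expect_const hs, ← Finset.mul_expect] at averaged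
  refine le_of_mul_le_mul_left (a := 2 * m / κ) ?_ (by positivity)
  calc 2 * m / κ * (c / 4 * κ) = c * m - c / 2 * m := by field_simp; ring
    _ ≤ _ := by linarith

theorem pow_two_pow_le_pow {c t : ℝ} (h₀ : 0 ≤ c * t ^ 2) (h₁ : c * t ^ 2 ≤ 1) {n k : ℕ}
    (hn : n ≤ 2 ^ k) : c ^ 2 ^ k * t ^ 2 ^ (k + 1) ≤ (c * t ^ 2) ^ n := by
  refine le_trans (le_of_eq ?_) (pow_le_pow_of_le_one h₀ h₁ hn)
  rw [mul_pow, ← pow_mul, pow_succ' 2 k]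

theorem eq_zero_of_support_subset {f : ℤ → ℂ} {N : ℝ}
    (h : Function.support f ⊆ ↑(initInterval N)) : ∀ x ∉ Finset.Icc 1 ⌊N⌋, f x = 0 :=
  fun _ hx => Function.notMem_support.1 fun hx' => hx (Finset.mem_coe.1 (h hx'))

theorem initInterval_natCast (q : ℕ) : initInterval q = Finset.Icc 1 (q : ℤ) := by
  rw [initInterval, Int.floor_natCast]

section LargeAverage

variable {M δ₂ δ₃ δ₄ : ℝ} {b : ℤ} {f : ℤ → ℂ}

theorem boxScale_le_of_le_boxAverage (hM : 1 ≤ M) (h₂ : 0 < δ₂) (h₃ : 0 < δ₃) (h₄ : 0 < δ₄)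
    (hδ : δ₃ < 1 / 2 ^ 21 * δ₂ ^ 3 * δ₄ ^ 4) (hb : b ∈ initInterval (δ₂ * M))
    (hf1 : IsOneBounded f) (hf : ∀ x ∉ Finset.Icc 1 ⌊2 * M ^ 2⌋, f x = 0)
    (h : δ₄ * M ^ 4 ≤ boxAverage 1 δ₂ δ₃ M b f) :
    boxScale δ₃ δ₄ ≤ 1 / 1000 ∧ boxScale δ₃ δ₄ ≤ δ₄ / 2 := by
  rw [initInterval, Finset.mem_Icc] at hb
  have h64 := mul_sq_le_of_le_boxAverage hM h₂ h₃ h₄ hδ (by omega) hf1 hf h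
  have hδ₄ := le_two_of_le_boxAverage (by linarith) h₃ (by omega) hf1 hf h
  exact ⟨boxScale_le h₄ hδ₄ h64, by linarith [boxScale_le_mul h₄ h64]⟩

theorem gowersNorm_four_pow_ge_of_le_boxAverage {N : ℝ} (hN : 0 < N) (hM : M = Real.sqrt N)
    (h₂ : 0 < δ₂) (h₃ : 0 < δ₃) (h₄ : 0 < δ₄) (hδ : δ₃ < 1 / 2 ^ 21 * δ₂ ^ 3 * δ₄ ^ 4)
    (hb : b ∈ initInterval (δ₂ * M)) (hf1 : IsOneBounded f)
    (hsupp : Function.support f ⊆ ↑(initInterval N))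
    (h : δ₄ * N * M ^ 2 ≤ boxAverage 1 δ₂ δ₃ M b f) :
    (1 / 2 ^ 20) ^ 2 ^ 19 * (δ₃ * δ₄) ^ 2 ^ 20 * N ^ 5 ≤ gowersNorm 4 f ^ 2 ^ 4 := by
  obtain ⟨M0, rfl⟩ : 0 < M ∧ N = M ^ 2 :=
    ⟨hM ▸ Real.sqrt_pos.2 hN, by rw [hM, Real.sq_sqrt hN.le]⟩
  have hf := eq_zero_of_support_subset hsupp
  obtain ⟨-, -, hL⟩ := floor_pos_of_boxAverage_pos hf (lt_of_lt_of_le (by positivity) h)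
  have hM1 : 1 ≤ M := (one_le_sq_iff₀ M0.le).1 (by exact_mod_cast Int.le_floor.1 hL)
  have hf' : ∀ x ∉ Finset.Icc 1 ⌊2 * M ^ 2⌋, f x = 0 := fun x hx => hf x fun h0 => hx <|
    Finset.Icc_subset_Icc le_rfl (Int.floor_le_floor (by linarith)) h0
  have h' : δ₄ * M ^ 4 ≤ boxAverage 1 δ₂ δ₃ M b f := by
    refine le_trans (le_of_eq ?_) h
    ring
  have hθ1 := (boxScale_le_of_le_boxAverage hM1 h₂ h₃ h₄ hδ hb hf1 hf' h').1
  calc _ ≤ boxScale δ₃ δ₄ ^ 4027 * (M ^ 2) ^ 5 := by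
        gcongr
        exact pow_two_pow_le_pow (boxScale_pos h₃ h₄).le (hθ1.trans (by norm_num)) (by norm_num)
    _ ≤ _ := boxScale_pow_mul_le_gowersNorm_four_pow hM1 h₂ h₃ h₄ hδ hb hf1 hf' h'

theorem expect_gowersNorm_four_pow_ge {ι : Type*} {s : Finset ι} {b : ι → ℤ} {g : ι → ℤ → ℂ}
    (hM : 1 ≤ M) (h₂ : 0 < δ₂) (h₃ : 0 < δ₃) (h₄ : 0 < δ₄)
    (hδ : δ₃ < 1 / 2 ^ 25 * δ₂ ^ 3 * δ₄ ^ 4) (hb : ∀ i ∈ s, b i ∈ initInterval (δ₂ * M))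
    (hg1 : ∀ i ∈ s, IsOneBounded (g i))
    (hg : ∀ i ∈ s, ∀ x ∉ Finset.Icc 1 ⌊2 * M ^ 2⌋, g i x = 0)
    (h : δ₄ * M ^ 4 ≤ 𝔼 i ∈ s, boxAverage 1 δ₂ δ₃ M (b i) (g i)) :
    (1 / 2 ^ 22) ^ 2 ^ 20 * (δ₃ * δ₄) ^ 2 ^ 21 * (M ^ 2) ^ 5 ≤
      𝔼 i ∈ s, gowersNorm 4 (g i) ^ 2 ^ 4 := by
  have hM0 : 0 < M := by linarith
  have hδ' : δ₃ < 1 / 2 ^ 21 * δ₂ ^ 3 * (δ₄ / 2) ^ 4 := by linarith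
  have hs : s.Nonempty := by
    by_contra hs
    rw [Finset.not_nonempty_iff_eq_empty.1 hs, Finset.expect_empty] at h
    exact absurd h (not_le.2 (by positivity))
  obtain ⟨i, hi, hi_large⟩ := Finset.exists_le_of_le_expect hs
    ((by gcongr; linarith : δ₄ / 2 * M ^ 4 ≤ δ₄ * M ^ 4).trans h)
  obtain ⟨hθ1, hθ₄⟩ := boxScale_le_of_le_boxAverage hM h₂ h₃ (by positivity) hδ' (hb i hi)
    (hg1 i hi) (hg i hi) hi_large
  have hθ0 := boxScale_pos h₃ (by positivity : 0 < δ₄ / 2)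
  have average : δ₄ / 4 * (boxScale δ₃ (δ₄ / 2) ^ 4027 * (M ^ 2) ^ 5) ≤
      𝔼 i ∈ s, gowersNorm 4 (g i) ^ 2 ^ 4 :=
    mul_le_expect_of_mul_le_expect hs (by positivity) (by positivity) h₄.le
      (fun i hi => by rw [gowersNorm_succ_pow 3 (hg i hi)]; positivity)
      (fun i hi => by
        have := hb i hi
        rw [initInterval, Finset.mem_Icc] at this
        exact boxAverage_le hM0 h₃ (by omega) (hg1 i hi) (hg i hi))
      (fun i hi => boxScale_pow_mul_le_gowersNorm_four_pow hM h₂ h₃ (by positivity) hδ'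
        (hb i hi) (hg1 i hi) (hg i hi)) h
  have boxScale_half : 1 / 2 ^ 22 * (δ₃ * δ₄) ^ 2 = boxScale δ₃ (δ₄ / 2) := by
    rw [boxScale]
    ring
  calc _ ≤ (1 / 2 ^ 22 * (δ₃ * δ₄) ^ 2) ^ 4028 * (M ^ 2) ^ 5 := by
        gcongr
        exact pow_two_pow_le_pow (by positivity) (by linarith) (by norm_num)
    _ = boxScale δ₃ (δ₄ / 2) * (boxScale δ₃ (δ₄ / 2) ^ 4027 * (M ^ 2) ^ 5) := by
        rw [boxScale_half, ← mul_assoc, ← pow_succ']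
    _ ≤ δ₄ / 4 * (boxScale δ₃ (δ₄ / 2) ^ 4027 * (M ^ 2) ^ 5) := by
        gcongr
        linarith
    _ ≤ _ := average

end LargeAverage

section ResidueAverage

variable {M δ₂ δ₃ δ₄ : ℝ} {q : ℕ} {f : ℤ → ℤ → ℂ}

theorem floor_natCast_mul_le {x : ℝ} (q : ℕ) (hx : 1 ≤ x) : ⌊q * x⌋ ≤ q * ⌊2 * x⌋ := by
  have h : (⌊q * x⌋ : ℝ) ≤ q * ⌊2 * x⌋ :=
    (Int.floor_le _).trans (mul_le_mul_of_nonneg_left (le_floor_two_mul hx) q.cast_nonneg)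
  exact_mod_cast h

theorem expect_boxAverage_eq (hM : 1 ≤ M) (hq : 0 < q)
    (hf : ∀ b ∈ initInterval (δ₂ * M), ∀ x ∉ Finset.Icc 1 ⌊q * M ^ 2⌋, f b x = 0) :
    𝔼 b ∈ initInterval (δ₂ * M), boxAverage q δ₂ δ₃ M b (f b) =
      q * 𝔼 p ∈ initInterval q ×ˢ initInterval (δ₂ * M),
        boxAverage 1 δ₂ δ₃ M p.2 (residueRescale q p.1 (f p.2)) := by
  rw [Finset.expect_product, Finset.expect_comm, Finset.mul_expect]
  refine Finset.expect_congr rfl fun b hb => ?_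
  have hA : 1 ≤ ⌊δ₂ * M⌋ := by
    rw [initInterval, Finset.mem_Icc] at hb
    omega
  rw [boxAverage_eq_sum_residueRescale hq (floor_natCast_mul_le q (one_le_pow₀ hM)) (hf b hb) hA,
    initInterval_natCast, ← Finset.card_mul_expect, Int.card_Icc]
  simp

theorem expect_gowersNormOn_four_pow_ge {N : ℝ} (hq : 0 < q) (hqN : (q : ℝ) ≤ N)
    (hM : M = Real.sqrt (N / q)) (h₂ : 0 < δ₂) (h₃ : 0 < δ₃) (h₄ : 0 < δ₄)
    (hδ : δ₃ < 1 / 2 ^ 25 * δ₂ ^ 3 * δ₄ ^ 4)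
    (hf : ∀ b ∈ initInterval (δ₂ * M),
      IsOneBounded (f b) ∧ Function.support (f b) ⊆ ↑(initInterval N))
    (h : δ₄ * N * M ^ 2 ≤ 𝔼 b ∈ initInterval (δ₂ * M), boxAverage q δ₂ δ₃ M b (f b)) :
    (1 / 2 ^ 22) ^ 2 ^ 20 * (δ₃ * δ₄) ^ 2 ^ 21 * (N / q) ^ 5 ≤
      𝔼 u ∈ initInterval q, 𝔼 b ∈ initInterval (δ₂ * M),
        gowersNormOn 4 (residueClass q u) (f b) ^ 2 ^ 4 := by
  have hq0 : (0 : ℝ) < q := by exact_mod_cast hq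
  have hNq : 1 ≤ N / q := (one_le_div hq0).2 hqN
  have hM1 : 1 ≤ M := hM ▸ Real.one_le_sqrt.2 hNq
  have hM2 : N / q = M ^ 2 := by rw [hM, Real.sq_sqrt (by linarith)]
  obtain rfl : N = q * M ^ 2 := by rw [← hM2, mul_div_cancel₀ _ hq0.ne']
  have hf0 := fun b hb => eq_zero_of_support_subset (hf b hb).2
  rw [expect_boxAverage_eq hM1 hq hf0] at h
  have h' := le_of_mul_le_mul_left (le_trans (by linarith : q * (δ₄ * M ^ 4) ≤ _) h) hq0
  simp only [gowersNormOn_residueClass 4 hq]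
  rw [hM2, ← Finset.expect_product' (initInterval q) (initInterval (δ₂ * M))
    fun u b => gowersNorm 4 (residueRescale q u (f b)) ^ 2 ^ 4]
  refine expect_gowersNorm_four_pow_ge hM1 h₂ h₃ h₄ hδ
    (fun p hp => (Finset.mem_product.1 hp).2)
    (fun p hp x => (hf p.2 (Finset.mem_product.1 hp).2).1 _) (fun p hp => ?_) h'
  rw [Finset.mem_product, initInterval_natCast] at hp
  exact residueRescale_eq_zero (floor_natCast_mul_le q (one_le_pow₀ hM1)) (hf0 p.2 hp.2) hp.1

end ResidueAverage

theorem lt_mul_pow_mul_pow_of_lt {C δ₁ δ₂ δ₃ δ₄ : ℝ} (hC : 0 < C) (hC1 : C ≤ 1) (h₁ : 0 < δ₁)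
    (h₂ : 0 < δ₂) (h₄ : 0 < δ₄) (h : δ₁ / δ₂ < C * δ₄) (h' : δ₃ < C * δ₁ ^ 3 * δ₄) :
    δ₃ < C * δ₂ ^ 3 * δ₄ ^ 4 := by
  rw [div_lt_iff₀ h₂] at h
  calc δ₃ < C * δ₁ ^ 3 * δ₄ := h'
    _ ≤ C * (C * δ₄ * δ₂) ^ 3 * δ₄ := by gcongr
    _ ≤ C * (1 * δ₄ * δ₂) ^ 3 * δ₄ := by gcongr
    _ = C * δ₂ ^ 3 * δ₄ ^ 4 := by ring

theorem lemma5p5_general :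
    (∃ C c : ℝ, 0 < C ∧ 0 < c ∧
      ∀ N M δ₂ δ₃ δ₄ : ℝ, 0 < N → M = Real.sqrt N →
        0 < δ₂ → 0 < δ₃ → 0 < δ₄ → δ₃ < C * δ₂ ^ 3 * δ₄ ^ 4 →
        ∀ b ∈ initInterval (δ₂ * M),
          ∀ f : ℤ → ℂ, IsOneBounded f → Function.support f ⊆ ↑(initInterval N) →
            δ₄ * N * M ^ 2 ≤ boxAverage 1 δ₂ δ₃ M b f →
            c * (δ₃ * δ₄) ^ (2 ^ 20) * N ^ 5 ≤ gowersNorm 4 f ^ (2 ^ 4)) ∧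
    (∃ C c : ℝ, 0 < C ∧ 0 < c ∧
      ∀ (N M δ₂ δ₃ δ₄ : ℝ) (q : ℕ), 0 < q → (q : ℝ) ≤ N → M = Real.sqrt (N / q) →
        0 < δ₂ → 0 < δ₃ → 0 < δ₄ → δ₃ < C * δ₂ ^ 3 * δ₄ ^ 4 →
        ∀ f : ℤ → ℤ → ℂ,
          (∀ b ∈ initInterval (δ₂ * M),
            IsOneBounded (f b) ∧ Function.support (f b) ⊆ ↑(initInterval N)) →
          δ₄ * N * M ^ 2 ≤ 𝔼 b ∈ initInterval (δ₂ * M), boxAverage q δ₂ δ₃ M b (f b) →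
          c * (δ₃ * δ₄) ^ (2 ^ 21) * (N / q) ^ 5 ≤
            𝔼 u ∈ initInterval q, 𝔼 b ∈ initInterval (δ₂ * M),
              gowersNormOn 4 (residueClass q u) (f b) ^ (2 ^ 4)) :=
  ⟨⟨1 / 2 ^ 21, (1 / 2 ^ 20) ^ 2 ^ 19, by norm_num, pow_pos (by norm_num) _,
      fun _ _ _ _ _ hN hM h₂ h₃ h₄ hδ _ hb _ hf1 hsupp h =>
        gowersNorm_four_pow_ge_of_le_boxAverage hN hM h₂ h₃ h₄ hδ hb hf1 hsupp h⟩,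
    ⟨1 / 2 ^ 25, (1 / 2 ^ 22) ^ 2 ^ 20, by norm_num, pow_pos (by norm_num) _,
      fun _ _ _ _ _ _ hq hqN hM h₂ h₃ h₄ hδ _ hf h =>
        expect_gowersNormOn_four_pow_ge hq hqN hM h₂ h₃ h₄ hδ hf h⟩⟩

theorem lemma5p5 :
    (∃ C K c : ℝ, 0 < C ∧ 0 < K ∧ 0 < c ∧
      ∀ N M δ₁ δ₂ δ₃ δ₄ : ℝ, 0 < N → M = Real.sqrt N →
        0 < δ₁ → 0 < δ₂ → 0 < δ₃ → 0 < δ₄ →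
        δ₁ / δ₂ < C * δ₄ → δ₃ < C * δ₁ ^ 3 * δ₄ →
        ∃ B : Finset ℤ, B ⊆ initInterval (δ₂ * M) ∧ (B.card : ℝ) ≤ K * (δ₁ * δ₂ * M) ∧
          ∀ b ∈ initInterval (δ₂ * M), b ∉ B →
            ∀ f : ℤ → ℂ, IsOneBounded f → Function.support f ⊆ ↑(initInterval N) →
              δ₄ * N * M ^ 2 ≤ boxAverage 1 δ₂ δ₃ M b f →
              c * (δ₃ * δ₄) ^ (2 ^ 20) * N ^ 5 ≤ gowersNorm 4 f ^ (2 ^ 4)) ∧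
    (∃ C c : ℝ, 0 < C ∧ 0 < c ∧
      ∀ (N M δ₂ δ₃ δ₄ : ℝ) (q : ℕ), 0 < q → (q : ℝ) ≤ N → M = Real.sqrt (N / q) →
        0 < δ₂ → 0 < δ₃ → 0 < δ₄ → δ₃ < C * δ₂ ^ 3 * δ₄ ^ 4 →
        ∀ f : ℤ → ℤ → ℂ,
          (∀ b ∈ initInterval (δ₂ * M),
            IsOneBounded (f b) ∧ Function.support (f b) ⊆ ↑(initInterval N)) →
          δ₄ * N * M ^ 2 ≤ 𝔼 b ∈ initInterval (δ₂ * M), boxAverage q δ₂ δ₃ M b (f b) →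
          c * (δ₃ * δ₄) ^ (2 ^ 21) * (N / q) ^ 5 ≤
            𝔼 u ∈ initInterval q, 𝔼 b ∈ initInterval (δ₂ * M),
              gowersNormOn 4 (residueClass q u) (f b) ^ (2 ^ 4)) := by
  obtain ⟨⟨C, c, hC, hc, fixed_shift⟩, residues⟩ := lemma5p5_general
  refine ⟨⟨min C 1, 1, c, lt_min hC one_pos, one_pos, hc, ?_⟩, residues⟩
  intro N M δ₁ δ₂ δ₃ δ₄ hN hM h₁ h₂ h₃ h₄ hδ₁ hδ₃
  have hδ : δ₃ < C * δ₂ ^ 3 * δ₄ ^ 4 :=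
    (lt_mul_pow_mul_pow_of_lt (lt_min hC one_pos) (min_le_right _ _) h₁ h₂ h₄ hδ₁ hδ₃).trans_le
      (by gcongr; exact min_le_left _ _)
  have hM0 : 0 ≤ M := hM ▸ Real.sqrt_nonneg N
  exact ⟨∅, Finset.empty_subset _, by rw [Finset.card_empty, Nat.cast_zero]; positivity,
    fun b hb _ => fixed_shift N M δ₂ δ₃ δ₄ hN hM h₂ h₃ h₄ hδ b hb⟩
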